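/- Let $n\ge 2$ be an integer, and write points of $\mathbb{R}^n$ as $(\mathbf{x},y)$ with $\mathbf{x}\in\mathbb{R}^{n-1}$, $y\in\mathbb{R}$. Let $g\in\mathbb{R}$, $\mathbf{c}\in\mathbb{R}^{n-1}$, $\eta\in C^1(\mathbb{R}^{n-1})$, put $$\Omega=\{(\mathbf{x},y): y<\eta(\mathbf{x})\},\qquad \Gamma=\{(\mathbf{x},\eta(\mathbf{x})):\mathbf{x}\in\mathbb{R}^{n-1}\},$$ and let $\phi\in C^\infty(\Omega)\cap C(\overline{\Omega})$. Write $[\phi]_\Gamma(\mathbf{x})=\phi(\mathbf{x},\eta(\mathbf{x}))$, and suppose that $\nabla\phi$ has a boundary value $[\nabla\phi]_\Gamma=([\nabla_{\mathbf{x}}\phi]_\Gamma,[\phi_y]_\Gamma)$ on $\Gamma$ in the sense that $\nabla\phi(\mathbf{x},\eta(\mathbf{x})-s)\to[\nabla\phi]_\Gamma(\mathbf{x})$ in $L^2_{\mathrm{loc}}(\mathbb{R}^{n-1})$ as $s\downarrow0$ (this holds in particular, with the pointwise restriction as boundary value, if $\nabla\phi$ extends continuously to $\Omega\cup\Gamma$).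 Assume that $(\eta,\phi,\mathbf{c})$ solves the deep-water solitary wave problem without surface tension: $$\Delta\phi=0\ \text{ in }\Omega,$$ $$[\phi_y]_\Gamma=([\nabla_{\mathbf{x}}\phi]_\Gamma-\mathbf{c})\cdot\nabla\eta\quad\text{and}\quad \tfrac12\bigl|[\nabla\phi]_\Gamma\bigr|^2-\mathbf{c}\cdot[\nabla_{\mathbf{x}}\phi]_\Gamma+g\eta=0\quad\text{for almost every }\mathbf{x}\in\mathbb{R}^{n-1},$$ $$\eta(\mathbf{x})\to0\ \text{ as }|\mathbf{x}|\to\infty,\qquad \phi(\mathbf{x},y)\to0\ \text{ as }|(\mathbf{x},y)|\to\infty,\ (\mathbf{x},y)\in\overline{\Omega}.$$ Assume moreover that $\eta\in H^1(\mathbb{R}^{n-1})$, $\mathbf{x}\cdot\nabla\eta\in L^2(\mathbb{R}^{n-1})$, $\nabla\phi\in L^2(\Omega)$, $(\mathbf{x},y)\cdot\nabla\phi\in L^2(\Omega)$, $[\phi]_\Gamma\in H^1(\mathbb{R}^{n-1})$ and $\mathbf{x}\cdot[\nabla_{\mathbf{x}}\phi]_\Gamma\in L^2(\mathbb{R}^{n-1})$.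 If $g\le0$, then $\phi\equiv0$ on $\overline{\Omega}$, and, unless both $g=0$ and $\mathbf{c}=\mathbf{0}$, also $\eta\equiv0$. -/

import Mathlib

open MeasureTheory Filter Topology
open scoped ContDiff InnerProductSpace

noncomputable section

namespace DeepWater

/-- The horizontal space `ℝⁿ⁻¹`, with its Euclidean norm and Lebesgue measure. Points `(𝐱, y)` of
`ℝⁿ` are elements of `Horiz n × ℝ`, whose volume is `n`-dimensional Lebesgue measure. -/
abbrev Horiz (n : ℕ) : Type := EuclideanSpace ℝ (Fin (n - 1))

variable {n : ℕ}

/-- The fluid domain `Ω = {(𝐱, y) : -∞ < y < η(𝐱)}`. -/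
def fluidDomain (η : Horiz n → ℝ) : Set (Horiz n × ℝ) := {p | p.2 < η p.1}

/-- The horizontal gradient `∇_𝐱 φ` at `p = (𝐱, y)`. -/
def gradX (φ : Horiz n × ℝ → ℝ) (p : Horiz n × ℝ) : Horiz n :=
  gradient (fun x => φ (x, p.2)) p.1

/-- The vertical derivative `φ_y` at `p = (𝐱, y)`. -/
def derivY (φ : Horiz n × ℝ → ℝ) (p : Horiz n × ℝ) : ℝ :=
  deriv (fun y => φ (p.1, y)) p.2

/-- The Laplacian of `φ` in all `n` variables at `p = (𝐱, y)`: the horizontal Laplacian plus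
`φ_yy`. -/
def laplace (φ : Horiz n × ℝ → ℝ) (p : Horiz n × ℝ) : ℝ :=
  Laplacian.laplacian (fun x => φ (x, p.2)) p.1 + iteratedDeriv 2 (fun y => φ (p.1, y)) p.2

/-- `F` is the weak (distributional) gradient of `f` on `ℝⁿ⁻¹`. -/
def HasWeakGradient (f : Horiz n → ℝ) (F : Horiz n → Horiz n) : Prop :=
  ∀ χ : Horiz n → ℝ, ContDiff ℝ ∞ χ → HasCompactSupport χ →
    ∀ v : Horiz n, ∫ x, f x * fderiv ℝ χ x v = -∫ x, ⟪F x, v⟫_ℝ * χ x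

/-- The Sobolev space `H¹(ℝⁿ⁻¹)`. -/
def MemH1 (f : Horiz n → ℝ) : Prop :=
  MemLp f 2 ∧ ∃ F : Horiz n → Horiz n, MemLp F 2 ∧ HasWeakGradient f F

/-- `(Gx, Gy)` is the boundary value `[∇φ]_Γ = ([∇_𝐱 φ]_Γ, [φ_y]_Γ)` of the gradient of `φ` on the
surface `Γ = {y = η(𝐱)}`: the functions `𝐱 ↦ ∇φ(𝐱, η(𝐱) - s)` converge to it in `L²_loc(ℝⁿ⁻¹)` as
`s ↓ 0`. When `∇φ` extends continuously to `Ω ∪ Γ` (and `η` is continuous) this convergence holds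
automatically, with the restriction of the extension to `Γ` as the limit. -/
structure IsBoundaryGradient (η : Horiz n → ℝ) (φ : Horiz n × ℝ → ℝ)
    (Gx : Horiz n → Horiz n) (Gy : Horiz n → ℝ) : Prop where
  aestronglyMeasurable_x : AEStronglyMeasurable Gx
  aestronglyMeasurable_y : AEStronglyMeasurable Gy
  tendsto_x : ∀ R : ℝ, Tendsto
    (fun s : ℝ => eLpNorm (fun x => gradX φ (x, η x - s) - Gx x) 2
      (volume.restrict (Metric.ball 0 R))) (𝓝[>] 0) (𝓝 0)
  tendsto_y : ∀ R : ℝ, Tendsto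
    (fun s : ℝ => eLpNorm (fun x => derivY φ (x, η x - s) - Gy x) 2
      (volume.restrict (Metric.ball 0 R))) (𝓝[>] 0) (𝓝 0)

/-- The solitary wave problem in deep water without surface tension, for the surface profile `η`,
the velocity potential `φ` (of which only the values on the closure of the fluid domain matter),
the wave velocity `c` and the gravity constant `g`; `(Gx, Gy)` is the boundary value of `∇φ`. -/
structure IsSolitaryWave (g : ℝ) (c : Horiz n) (η : Horiz n → ℝ) (φ : Horiz n × ℝ → ℝ)
    (Gx : Horiz n → Horiz n) (Gy : Horiz n → ℝ) : Prop where
  boundaryGradient : IsBoundaryGradient η φ Gx Gy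
  harmonic : ∀ p ∈ fluidDomain η, laplace φ p = 0
  kinematic : ∀ᵐ x, Gy x = ⟪Gx x - c, gradient η x⟫_ℝ
  bernoulli : ∀ᵐ x, (1 / 2 : ℝ) * (‖Gx x‖ ^ 2 + Gy x ^ 2) - ⟪c, Gx x⟫_ℝ + g * η x = 0
  tendsto_surface : Tendsto η (cocompact (Horiz n)) (𝓝 0)
  tendsto_potential :
    Tendsto φ (cocompact (Horiz n × ℝ) ⊓ 𝓟 (closure (fluidDomain η))) (𝓝 0)

end DeepWater

end

/-! Everything follows from one virial identity, `IsSolitaryWave.virial`: `n ∫_Ω |∇φ|² = (n + 1) g ∫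
η²`. For `g ≤ 0` its sides have opposite signs, so both vanish. Then `φ_y = 0` in `Ω`, and decay
along downward vertical lines gives `φ = 0`. If `g ≠ 0`, then `∫ η² = 0`. If `g = 0` and `c ≠ 0`,
the kinematic condition becomes `c · ∇η = 0`, so `η` is constant along lines parallel to `c` and
decay gives `η = 0`.

For the identity, write `X = (x, y)`, `N = (-∇η, 1)`, and `G` for the boundary value of `∇φ`. Three
fluxes through the surface are computed: (Rellich) `(X·∇φ)∇φ - |∇φ|² X / 2` has divergence `(1 -
n/2)|∇φ|²`; (curl) `(X·∇φ)c - (c·∇φ)X + (n-1)φ c` has divergence zero; (energy) `φ∇φ` has divergence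
`|∇φ|²`. On the surface `G·N = c·N` and `|G|²/2 = c·G - gη`. Hence the Rellich flux is `∫
((X·G)(c·N) - (c·G)(X·N)) + g ∫ η(η - x·∇η)`. The curl and energy identities evaluate the first
integral as `-(n-1) ∫_Ω |∇φ|²`, and an integration by parts turns the second into `(n+1)/2 ∫ η²`.

Three analytic points need care. The boundary value of `∇φ` exists only in `L²_loc`, so the
divergence theorem is used at depth `s` below the surface and `s ↓ 0` is taken afterwards
(`setIntegral_div_subgraph`). The domain is unbounded: the Rellich and curl fields are localised by
cutoffs with `|X| |∇χ|` bounded, while in the energy identity, where `φ` is not assumed to lie in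
`L²(Ω)`, the values of `φ` are truncated near zero instead. Finally, `G` lies in `L²` because its
tangential part is controlled by the trace of `φ` in `H¹` and its normal part by the kinematic
condition (`IsSolitaryWave.memLp_boundaryGradient`). -/

noncomputable section

namespace DeepWater

set_option linter.unusedSectionVars false

/-! ### Flattening the domain, and the divergence theorem at positive depth -/

variable {E : Type*} [NormedAddCommGroup E] [InnerProductSpace ℝ E] [FiniteDimensional ℝ E]
  [MeasurableSpace E] [BorelSpace E]

/-- The open region `{(x, y) : y < η x}` below the graph of `η`. -/
def subgraph (η : E → ℝ) : Set (E × ℝ) := {p | p.2 < η p.1}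

lemma isOpen_subgraph {η : E → ℝ} (hη : Continuous η) : IsOpen (subgraph η) :=
  isOpen_lt continuous_snd (hη.comp continuous_fst)

/-- The volume preserving involution `(x, t) ↦ (x, η x - t)`, which flattens the subgraph
of `η`. -/
def shear (η : E → ℝ) (hη : Continuous η) : E × ℝ ≃ᵐ E × ℝ where
  toFun q := (q.1, η q.1 - q.2)
  invFun q := (q.1, η q.1 - q.2)
  left_inv q := by simp
  right_inv q := by simp
  measurable_toFun := by
    have := hη.measurable
    simp only [Equiv.coe_fn_mk]
    fun_prop
  measurable_invFun := by
    have := hη.measurable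
    simp only [Equiv.coe_fn_symm_mk]
    fun_prop

/-- On each vertical line the map is a reflection of `ℝ`, so Fubini suffices and no Jacobian is
needed. -/
lemma measurePreserving_shear {η : E → ℝ} (hη : Continuous η) :
    MeasurePreserving (shear η hη) volume volume := by
  have := hη.measurable
  refine (MeasurePreserving.id (volume : Measure E)).skew_product
    (g := fun x t => η x - t) (by fun_prop) (ae_of_all _ fun x => ?_)
  exact (Measure.measurePreserving_sub_left (volume : Measure ℝ) (η x)).map_eq

lemma setIntegral_subgraph {η : E → ℝ} (hη : Continuous η) (s : ℝ) (f : E × ℝ → ℝ) :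
    ∫ p in subgraph (fun x => η x - s), f p =
      ∫ q in Set.univ ×ˢ Set.Ioi s, f (q.1, η q.1 - q.2) := by
  have h := (measurePreserving_shear hη).setIntegral_preimage_emb
    (shear η hη).measurableEmbedding f (subgraph (fun x => η x - s))
  rw [← h]
  have hs : (shear η hη) ⁻¹' (subgraph (fun x => η x - s)) = Set.univ ×ˢ Set.Ioi s := by
    ext q
    simp [shear, subgraph]
  rw [hs]
  rfl

/-- In flattened coordinates the region is a half-space. Horizontal derivatives integrate to zero
over each slice, and the vertical derivative is handled by the fundamental theorem of calculus on
each vertical line. The factor `v.2 - fderiv ℝ η x v.1` is the pairing of `v` with the unnormalised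
normal `(-∇η, 1)`. -/
lemma setIntegral_fderiv_subgraph_of_contDiff {η : E → ℝ} (hη : ContDiff ℝ 1 η)
    {f : E × ℝ → ℝ} (hf : ContDiff ℝ 1 f) (hfc : HasCompactSupport f) (s : ℝ) (v : E × ℝ) :
    ∫ p in subgraph (fun x => η x - s), fderiv ℝ f p v =
      ∫ x, f (x, η x - s) * (v.2 - fderiv ℝ η x v.1) := by
  set h : E × ℝ → ℝ := fun q => f (q.1, η q.1 - q.2) with hh
  have hS : ContDiff ℝ 1 (fun q : E × ℝ => (q.1, η q.1 - q.2)) := by fun_prop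
  have hhd : ContDiff ℝ 1 h := hf.comp hS
  let Φ : E × ℝ ≃ₜ E × ℝ :=
    { toFun := fun q => (q.1, η q.1 - q.2)
      invFun := fun q => (q.1, η q.1 - q.2)
      left_inv := fun q => by simp
      right_inv := fun q => by simp
      continuous_toFun := hS.continuous
      continuous_invFun := hS.continuous }
  have hhc : HasCompactSupport h := hfc.comp_homeomorph Φ
  have hηd : Differentiable ℝ η := hη.differentiable one_ne_zero
  -- Chain rule for `h`: `Dh(v₁, 0) = Df(v₁, Dη v₁)` and `Dh(0, 1) = -Df(0, 1)`; solving for `Df(v)`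
  -- gives this combination.
  have hder : ∀ q : E × ℝ, fderiv ℝ f (q.1, η q.1 - q.2) v =
      fderiv ℝ h q (v.1, 0) - (v.2 - fderiv ℝ η q.1 v.1) * fderiv ℝ h q (0, 1) := by
    intro q
    have h1 : HasFDerivAt (fun q : E × ℝ => (q.1, η q.1 - q.2))
        ((ContinuousLinearMap.fst ℝ E ℝ).prod
          ((fderiv ℝ η q.1).comp (ContinuousLinearMap.fst ℝ E ℝ) -
            ContinuousLinearMap.snd ℝ E ℝ)) q :=
      hasFDerivAt_fst.prodMk
        (((hηd q.1).hasFDerivAt.comp q hasFDerivAt_fst).sub hasFDerivAt_snd)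
    have h2 : HasFDerivAt h _ q :=
      ((hf.differentiable one_ne_zero (q.1, η q.1 - q.2)).hasFDerivAt).comp q h1
    rw [h2.fderiv]
    simp only [ContinuousLinearMap.comp_apply, ContinuousLinearMap.prod_apply,
      sub_apply, ContinuousLinearMap.coe_fst', ContinuousLinearMap.coe_snd',
      map_zero, sub_zero, zero_sub]
    rw [← smul_eq_mul, ← map_smul, ← map_sub]
    congr 1
    simp
  have hcd : Continuous fun q => fderiv ℝ h q := hhd.continuous_fderiv one_ne_zero
  have hcη : Continuous fun x => fderiv ℝ η x := hη.continuous_fderiv one_ne_zero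
  have hsupp : ∀ w : E × ℝ, HasCompactSupport fun q => fderiv ℝ h q w := fun w =>
    hhc.fderiv_apply ℝ w
  have i1 : Integrable (fun q => fderiv ℝ h q (v.1, 0)) :=
    Continuous.integrable_of_hasCompactSupport (by fun_prop) (hsupp _)
  have i2 : Integrable (fun q : E × ℝ =>
      (v.2 - fderiv ℝ η q.1 v.1) * fderiv ℝ h q (0, 1)) :=
    Continuous.integrable_of_hasCompactSupport (by fun_prop) (hsupp _).mul_left
  rw [setIntegral_subgraph hη.continuous]
  simp_rw [hder]
  rw [integral_sub i1.integrableOn i2.integrableOn]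
  have e1 : ∫ q in Set.univ ×ˢ Set.Ioi s, fderiv ℝ h q (v.1, 0) = 0 := by
    have i1' : Integrable (fun q => fderiv ℝ h q (v.1, 0))
        ((volume : Measure E).prod (volume.restrict (Set.Ioi s))) := by
      have := i1.integrableOn (s := Set.univ ×ˢ Set.Ioi s)
      rwa [IntegrableOn, Measure.volume_eq_prod, ← Measure.prod_restrict,
        Measure.restrict_univ] at this
    rw [Measure.volume_eq_prod, ← Measure.prod_restrict, Measure.restrict_univ,
      integral_prod_symm _ i1']
    refine integral_eq_zero_of_ae (ae_of_all _ fun t => ?_)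
    have hg : ContDiff ℝ 1 fun x : E => h (x, t) := hhd.comp (by fun_prop)
    have hgc : HasCompactSupport fun x : E => h (x, t) := by
      refine HasCompactSupport.of_support_subset_isCompact
        (K := Prod.fst '' tsupport h) (hhc.isCompact.image continuous_fst) ?_
      intro x hx
      exact ⟨(x, t), subset_tsupport _ hx, rfl⟩
    have hgd : ∀ x : E, fderiv ℝ h (x, t) (v.1, 0) = fderiv ℝ (fun x => h (x, t)) x v.1 := by
      intro x
      have h1 : HasFDerivAt (fun x : E => (x, t)) (ContinuousLinearMap.inl ℝ E ℝ) x :=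
        hasFDerivAt_prodMk_left x t
      have h2 := ((hhd.differentiable one_ne_zero (x, t)).hasFDerivAt).comp x h1
      have h3 : fderiv ℝ (fun x => h (x, t)) x = _ := h2.fderiv
      rw [h3]
      simp
    simp_rw [hgd]
    -- Integration by parts against the constant `1`.
    have h4 := integral_bilinear_fderiv_right_eq_neg_left_of_integrable (μ := (volume : Measure E))
      (B := ContinuousLinearMap.mul ℝ ℝ) (f := fun _ : E => (1 : ℝ)) (g := fun x => h (x, t))
      (v := v.1) (by simp)
      (by
        simp only [ContinuousLinearMap.mul_apply', one_mul]
        exact ((hg.continuous_fderiv one_ne_zero).clm_apply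
          continuous_const).integrable_of_hasCompactSupport (hgc.fderiv_apply ℝ _))
      (by simpa using hg.continuous.integrable_of_hasCompactSupport hgc)
      (fun x _ => differentiableAt_const _) (fun x _ => hg.differentiable one_ne_zero x)
    simpa using h4
  have e2 : ∫ q in Set.univ ×ˢ Set.Ioi s, (v.2 - fderiv ℝ η q.1 v.1) * fderiv ℝ h q (0, 1) =
      -∫ x, h (x, s) * (v.2 - fderiv ℝ η x v.1) := by
    have i2' : IntegrableOn (fun q : E × ℝ =>
      (v.2 - fderiv ℝ η q.1 v.1) * fderiv ℝ h q (0, 1)) (Set.univ ×ˢ Set.Ioi s)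
        ((volume : Measure E).prod volume) := i2.integrableOn
    rw [Measure.volume_eq_prod, setIntegral_prod _ i2', setIntegral_univ, ← integral_neg]
    congr 1 with x
    simp only
    rw [integral_const_mul]
    have hg : ContDiff ℝ 1 fun t : ℝ => h (x, t) := hhd.comp (by fun_prop)
    have hgc : HasCompactSupport fun t : ℝ => h (x, t) := by
      refine HasCompactSupport.of_support_subset_isCompact
        (K := Prod.snd '' tsupport h) (hhc.isCompact.image continuous_snd) ?_
      intro t ht
      exact ⟨(x, t), subset_tsupport _ ht, rfl⟩
    have hgd : ∀ t : ℝ, fderiv ℝ h (x, t) (0, 1) = deriv (fun t => h (x, t)) t := by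
      intro t
      have h1 : HasFDerivAt (fun t : ℝ => (x, t)) (ContinuousLinearMap.inr ℝ E ℝ) t :=
        hasFDerivAt_prodMk_right x t
      have h2 := (((hhd.differentiable one_ne_zero (x, t)).hasFDerivAt).comp t h1).hasDerivAt
      have h3 : deriv (fun t => h (x, t)) t = _ := h2.deriv
      rw [h3]
      simp
    simp_rw [hgd]
    rw [hgc.integral_Ioi_deriv_eq hg]
    ring
  rw [e1, e2]
  simp [hh]

/-- A `C¹` function below the graph of `η`, vanishing off a compact set, agrees at distance `s`
below the graph with a compactly supported `C¹` function on the whole space. -/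
lemma exists_contDiff_eqOn_subgraph {η : E → ℝ} (hη : ContDiff ℝ 1 η) {f : E × ℝ → ℝ}
    (hf : ContDiffOn ℝ 1 f (subgraph η)) {K : Set (E × ℝ)} (hK : IsCompact K)
    (hfK : ∀ p ∈ subgraph η, p ∉ K → f p = 0) {s : ℝ} (hs : 0 < s) :
    ∃ g : E × ℝ → ℝ, ContDiff ℝ 1 g ∧ HasCompactSupport g ∧
      ∀ p : E × ℝ, p.2 ≤ η p.1 - s → g p = f p := by
  -- The argument is at most `0` at depth at most `s / 2` and at least `1` at depth at least `s`, so
  -- `ρ * f` is smooth across the graph and unchanged from depth `s` on.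
  let ρ : E × ℝ → ℝ := fun p => Real.smoothTransition (2 / s * (η p.1 - p.2) - 1)
  have hρ : ContDiff ℝ 1 ρ := by
    have : ContDiff ℝ 1 Real.smoothTransition := Real.smoothTransition.contDiff
    exact this.comp (by fun_prop)
  have hρ0 : ∀ p : E × ℝ, η p.1 - s / 2 < p.2 → ρ p = 0 := by
    intro p hp
    refine Real.smoothTransition.zero_of_nonpos ?_
    have h1 : 2 / s * (η p.1 - p.2) ≤ 2 / s * (s / 2) := by gcongr; linarith
    have h2 : 2 / s * (s / 2) = 1 := by field_simp
    linarith
  have hO := isOpen_subgraph hη.continuous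
  refine ⟨fun p => ρ p * f p, ?_, ?_, ?_⟩
  · rw [contDiff_iff_contDiffAt]
    intro p
    by_cases hp : p ∈ subgraph η
    · exact hρ.contDiffAt.mul (hf.contDiffAt (hO.mem_nhds hp))
    · have hop : IsOpen {q : E × ℝ | η q.1 - s / 2 < q.2} :=
        isOpen_lt (by have := hη.continuous; fun_prop) continuous_snd
      have hpm : p ∈ {q : E × ℝ | η q.1 - s / 2 < q.2} := by
        simp only [subgraph, Set.mem_ofPred_eq, not_lt] at hp ⊢
        linarith
      refine (contDiffAt_const (c := (0 : ℝ))).congr_of_eventuallyEq ?_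
      filter_upwards [hop.mem_nhds hpm] with q hq
      rw [hρ0 q hq, zero_mul]
  · refine HasCompactSupport.of_support_subset_isCompact hK ?_
    intro p hp
    by_contra hpK
    apply hp
    by_cases hpS : p ∈ subgraph η
    · simp [hfK p hpS hpK]
    · have : ρ p = 0 := hρ0 p (by
        simp only [subgraph, Set.mem_ofPred_eq, not_lt] at hpS
        linarith)
      simp [this]
  · intro p hp
    have : ρ p = 1 := by
      refine Real.smoothTransition.one_of_one_le ?_
      have h1 : 2 / s * s ≤ 2 / s * (η p.1 - p.2) := by gcongr; linarith
      have h2 : 2 / s * s = 2 := by field_simp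
      linarith
    simp [this]

lemma setIntegral_fderiv_subgraph {η : E → ℝ} (hη : ContDiff ℝ 1 η) {f : E × ℝ → ℝ}
    (hf : ContDiffOn ℝ 1 f (subgraph η)) {K : Set (E × ℝ)} (hK : IsCompact K)
    (hfK : ∀ p ∈ subgraph η, p ∉ K → f p = 0) {s : ℝ} (hs : 0 < s) (v : E × ℝ) :
    IntegrableOn (fun p => fderiv ℝ f p v) (subgraph (fun x => η x - s)) ∧
    Integrable (fun x => f (x, η x - s) * (v.2 - fderiv ℝ η x v.1)) ∧
    ∫ p in subgraph (fun x => η x - s), fderiv ℝ f p v =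
      ∫ x, f (x, η x - s) * (v.2 - fderiv ℝ η x v.1) := by
  obtain ⟨g, hg, hgc, hgf⟩ := exists_contDiff_eqOn_subgraph hη hf hK hfK hs
  have hO : IsOpen (subgraph fun x => η x - s) :=
    isOpen_subgraph (by have := hη.continuous; fun_prop)
  have hd : ∀ p ∈ subgraph (fun x => η x - s), fderiv ℝ g p v = fderiv ℝ f p v := by
    intro p hp
    have : g =ᶠ[𝓝 p] f := by
      filter_upwards [hO.mem_nhds hp] with q hq
      exact hgf q (le_of_lt hq)
    rw [this.fderiv_eq]
  have hb : ∀ x, g (x, η x - s) = f (x, η x - s) := fun x => hgf _ le_rfl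
  refine ⟨?_, ?_, ?_⟩
  · refine IntegrableOn.congr_fun ?_ hd hO.measurableSet
    exact (((hg.continuous_fderiv one_ne_zero).clm_apply
          continuous_const).integrable_of_hasCompactSupport (hgc.fderiv_apply ℝ _)).integrableOn
  · simp_rw [← hb]
    have hcη : Continuous fun x => fderiv ℝ η x := hη.continuous_fderiv one_ne_zero
    have := hη.continuous
    have := hg.continuous
    refine Continuous.integrable_of_hasCompactSupport (by fun_prop) (HasCompactSupport.mul_right ?_)
    refine HasCompactSupport.of_support_subset_isCompact
        (K := Prod.fst '' tsupport g) (hgc.isCompact.image continuous_fst) ?_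
    intro x hx
    exact ⟨(x, _), subset_tsupport _ hx, rfl⟩
  · rw [← setIntegral_congr_fun hO.measurableSet hd,
      setIntegral_fderiv_subgraph_of_contDiff hη hg hgc]
    simp_rw [hb]

/-! ### Local convergence to boundary values -/

/-- `f s → g` in `L^p_loc` as `s ↓ 0`. -/
structure TendstoLocLp (p : ENNReal) (f : ℝ → E → ℝ) (g : E → ℝ) : Prop where
  aestronglyMeasurable : ∀ s, 0 < s → AEStronglyMeasurable (f s) volume
  memLp : ∀ R : ℝ, MemLp g p (volume.restrict (Metric.ball 0 R))
  tendsto : ∀ R : ℝ, Tendsto (fun s => eLpNorm (f s - g) p (volume.restrict (Metric.ball 0 R)))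
    (𝓝[>] 0) (𝓝 0)

namespace TendstoLocLp

variable {p q r : ENNReal} {f f₁ f₂ : ℝ → E → ℝ} {g g₁ g₂ : E → ℝ}

lemma add (hp : 1 ≤ p) (h₁ : TendstoLocLp p f₁ g₁) (h₂ : TendstoLocLp p f₂ g₂) :
    TendstoLocLp p (fun s x => f₁ s x + f₂ s x) (fun x => g₁ x + g₂ x) where
  aestronglyMeasurable s hs := (h₁.aestronglyMeasurable s hs).add (h₂.aestronglyMeasurable s hs)
  memLp R := (h₁.memLp R).add (h₂.memLp R)
  tendsto R := by
    have h := (h₁.tendsto R).add (h₂.tendsto R)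
    rw [add_zero] at h
    refine tendsto_of_tendsto_of_tendsto_of_le_of_le' tendsto_const_nhds h
      (Eventually.of_forall fun _ => zero_le) ?_
    filter_upwards [self_mem_nhdsWithin] with s hs
    have e : ((fun x => f₁ s x + f₂ s x) - fun x => g₁ x + g₂ x) =
        (f₁ s - g₁) + (f₂ s - g₂) := by
      ext x
      simp only [Pi.sub_apply, Pi.add_apply]
      ring
    rw [e]
    exact eLpNorm_add_le ((h₁.aestronglyMeasurable s hs).restrict.sub (h₁.memLp R).1)
      ((h₂.aestronglyMeasurable s hs).restrict.sub (h₂.memLp R).1) hp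

lemma const_mul (h : TendstoLocLp p f g) (a : ℝ) :
    TendstoLocLp p (fun s x => a * f s x) (fun x => a * g x) where
  aestronglyMeasurable s hs := (h.aestronglyMeasurable s hs).const_mul a
  memLp R := (h.memLp R).const_mul a
  tendsto R := by
    have e : ∀ s, ((fun x => a * f s x) - fun x => a * g x) = a • (f s - g) := by
      intro s
      ext x
      simp only [Pi.sub_apply, Pi.smul_apply, smul_eq_mul]
      ring
    simp_rw [e, eLpNorm_const_smul]
    simpa using ENNReal.Tendsto.const_mul (h.tendsto R) (Or.inr enorm_ne_top)

lemma sub (hp : 1 ≤ p) (h₁ : TendstoLocLp p f₁ g₁) (h₂ : TendstoLocLp p f₂ g₂) :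
    TendstoLocLp p (fun s x => f₁ s x - f₂ s x) (fun x => g₁ x - g₂ x) := by
  simpa [sub_eq_add_neg] using h₁.add hp (h₂.const_mul (-1))

lemma of_continuous (p : ENNReal) (hg : Continuous g) : TendstoLocLp p (fun _ => g) g where
  aestronglyMeasurable _ _ := hg.aestronglyMeasurable
  memLp R := by
    have h : MemLp g ⊤ (volume.restrict (Metric.ball 0 R)) := by
      obtain ⟨C, hC⟩ := (isCompact_closedBall (0 : E) R).exists_bound_of_continuousOn
        hg.continuousOn
      refine memLp_top_of_bound hg.aestronglyMeasurable C ?_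
      filter_upwards [ae_restrict_mem Metric.isOpen_ball.measurableSet] with x hx
      exact hC x (Metric.ball_subset_closedBall hx)
    have : IsFiniteMeasure (volume.restrict (Metric.ball (0 : E) R)) :=
      ⟨by simpa using measure_ball_lt_top⟩
    exact h.mono_exponent le_top
  tendsto R := by simp

lemma sum {A : Type*} (s : Finset A) (hp : 1 ≤ p) {f : A → ℝ → E → ℝ} {g : A → E → ℝ}
    (h : ∀ a, TendstoLocLp p (f a) (g a)) :
    TendstoLocLp p (fun t x => ∑ a ∈ s, f a t x) (fun x => ∑ a ∈ s, g a x) := by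
  classical
  induction s using Finset.induction_on with
  | empty => simpa using of_continuous p (E := E) (continuous_const (y := (0 : ℝ)))
  | insert a s ha ih => simpa [Finset.sum_insert ha] using (h a).add hp ih

/-- Hölder's inequality applied to `f₁f₂ - g₁g₂ = (f₁ - g₁)f₂ + g₁(f₂ - g₂)`, where the norm of `f₂`
is at most that of `f₂ - g₂` plus that of `g₂`. -/
lemma mul [ENNReal.HolderTriple p q r] (hq : 1 ≤ q) (hr : 1 ≤ r)
    (h₁ : TendstoLocLp p f₁ g₁) (h₂ : TendstoLocLp q f₂ g₂) :
    TendstoLocLp r (fun s x => f₁ s x * f₂ s x) (fun x => g₁ x * g₂ x) where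
  aestronglyMeasurable s hs := (h₁.aestronglyMeasurable s hs).mul (h₂.aestronglyMeasurable s hs)
  memLp R := (h₂.memLp R).mul' (h₁.memLp R)
  tendsto R := by
    set μ := volume.restrict (Metric.ball (0 : E) R)
    have hb : Tendsto (fun s => eLpNorm (f₁ s - g₁) p μ *
        (eLpNorm (f₂ s - g₂) q μ + eLpNorm g₂ q μ) +
          eLpNorm g₁ p μ * eLpNorm (f₂ s - g₂) q μ) (𝓝[>] 0)
        (𝓝 (0 * (0 + eLpNorm g₂ q μ) + eLpNorm g₁ p μ * 0)) := by
      refine (ENNReal.Tendsto.mul (h₁.tendsto R) (Or.inr ?_)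
        ((h₂.tendsto R).add tendsto_const_nhds) (Or.inr ENNReal.zero_ne_top)).add
        (ENNReal.Tendsto.const_mul (h₂.tendsto R) (Or.inr (h₁.memLp R).2.ne))
      rw [zero_add]
      exact (h₂.memLp R).2.ne
    simp only [zero_mul, mul_zero, add_zero] at hb
    refine tendsto_of_tendsto_of_tendsto_of_le_of_le' tendsto_const_nhds hb
      (Eventually.of_forall fun _ => zero_le) ?_
    filter_upwards [self_mem_nhdsWithin] with s hs
    have m₁ : AEStronglyMeasurable (f₁ s - g₁) μ :=
      (h₁.aestronglyMeasurable s hs).restrict.sub (h₁.memLp R).1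
    have m₂ : AEStronglyMeasurable (f₂ s - g₂) μ :=
      (h₂.aestronglyMeasurable s hs).restrict.sub (h₂.memLp R).1
    have m₃ : AEStronglyMeasurable (f₂ s) μ := (h₂.aestronglyMeasurable s hs).restrict
    have e : ((fun x => f₁ s x * f₂ s x) - fun x => g₁ x * g₂ x) =
        (f₁ s - g₁) • f₂ s + g₁ • (f₂ s - g₂) := by
      ext x
      simp only [Pi.sub_apply, Pi.add_apply, Pi.mul_apply, smul_eq_mul]
      ring
    have e₂ : f₂ s = (f₂ s - g₂) + g₂ := by simp
    rw [e]
    refine (eLpNorm_add_le (m₁.smul m₃) ((h₁.memLp R).1.smul m₂) hr).trans ?_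
    refine add_le_add ((eLpNorm_smul_le_mul_eLpNorm (p := p) (q := q) m₃ m₁).trans ?_)
      (eLpNorm_smul_le_mul_eLpNorm (p := p) (q := q) m₂ (h₁.memLp R).1)
    gcongr
    calc eLpNorm (f₂ s) q μ = eLpNorm ((f₂ s - g₂) + g₂) q μ := by rw [← e₂]
      _ ≤ _ := eLpNorm_add_le m₂ (h₂.memLp R).1 hq

/-- Off `S` the function `f s - g` is just `-g`, so the `L¹` norm of `g` over the part of any ball
outside `S` is at most a quantity tending to zero. -/
lemma ae_eq_zero_of_forall_notMem (h : TendstoLocLp 1 f g) {S : Set E} (hS : MeasurableSet S)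
    (hf : ∀ s, 0 < s → ∀ x, x ∉ S → f s x = 0) : ∀ᵐ x, x ∉ S → g x = 0 := by
  have hN : ∀ N : ℕ, ∀ᵐ x ∂(volume.restrict (Metric.ball (0 : E) N)), x ∉ S → g x = 0 := by
    intro N
    refine (ae_restrict_iff' hS.compl).1 ?_
    rw [Measure.restrict_restrict hS.compl]
    have hle : (volume.restrict (Sᶜ ∩ Metric.ball (0 : E) N)) ≤
      volume.restrict (Metric.ball (0 : E) N) := Measure.restrict_mono Set.inter_subset_right le_rfl
    have h0 : eLpNorm g 1 (volume.restrict (Sᶜ ∩ Metric.ball (0 : E) N)) = 0 := by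
      refine le_antisymm (ge_of_tendsto (h.tendsto N) ?_) zero_le
      filter_upwards [self_mem_nhdsWithin] with s hs
      refine le_trans (le_of_eq ?_) (eLpNorm_mono_measure _ hle)
      rw [← eLpNorm_neg]
      refine eLpNorm_congr_ae ?_
      filter_upwards [ae_restrict_mem (hS.compl.inter Metric.isOpen_ball.measurableSet)] with x hx
      simp [hf s hs x hx.1]
    exact (eLpNorm_eq_zero_iff ((h.memLp N).1.mono_measure hle) one_ne_zero).1 h0
  have hU : (⋃ N : ℕ, Metric.ball (0 : E) N) = Set.univ := Metric.iUnion_ball_nat 0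
  rw [← Measure.restrict_univ (μ := volume), ← hU, ae_restrict_iUnion_iff]
  exact hN

lemma tendsto_integral (h : TendstoLocLp 1 f g) {R : ℝ}
    (hf : ∀ s, 0 < s → ∀ x, x ∉ Metric.ball (0 : E) R → f s x = 0) :
    Tendsto (fun s => ∫ x, f s x) (𝓝[>] 0) (𝓝 (∫ x, g x)) := by
  -- The limit inherits the common support, so both global integrals are integrals over one ball,
  -- where `L¹` convergence is available.
  have hg := h.ae_eq_zero_of_forall_notMem Metric.isOpen_ball.measurableSet hf
  rw [← setIntegral_eq_integral_of_ae_compl_eq_zero hg]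
  have h1 : Tendsto (fun s => ∫ x in Metric.ball 0 R, f s x) (𝓝[>] 0)
      (𝓝 (∫ x in Metric.ball 0 R, g x)) := by
    refine tendsto_integral_of_L1' g (memLp_one_iff_integrable.1 (h.memLp R)).1 ?_ (h.tendsto R)
    have hlt : ∀ᶠ s in 𝓝[>] (0 : ℝ),
        eLpNorm (f s - g) 1 (volume.restrict (Metric.ball 0 R)) < 1 :=
      (h.tendsto R).eventually (gt_mem_nhds zero_lt_one)
    filter_upwards [hlt, self_mem_nhdsWithin] with s hs hs0
    have : MemLp (f s - g) 1 (volume.restrict (Metric.ball 0 R)) :=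
      ⟨(h.aestronglyMeasurable s hs0).restrict.sub (h.memLp R).1, hs.trans ENNReal.one_lt_top⟩
    have h2 := this.add (h.memLp R)
    rw [sub_add_cancel] at h2
    exact memLp_one_iff_integrable.1 h2
  refine h1.congr' ?_
  filter_upwards [self_mem_nhdsWithin] with s hs
  exact setIntegral_eq_integral_of_forall_compl_eq_zero (hf s hs)

/-- A function that is continuous up to the graph of `η` converges to its boundary values
locally uniformly. -/
lemma of_continuousOn {η : E → ℝ} (hη : Continuous η) {M : E × ℝ → ℝ}
    (hM : ContinuousOn M {p | p.2 ≤ η p.1}) :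
    TendstoLocLp ⊤ (fun s x => M (x, η x - s)) (fun x => M (x, η x)) := by
  have hc : ∀ s, 0 ≤ s → Continuous fun x => M (x, η x - s) := fun s hs =>
    hM.comp_continuous (by fun_prop) fun x => by simpa using hs
  have hc0 : Continuous fun x => M (x, η x) := by simpa using hc 0 le_rfl
  refine ⟨fun s hs => (hc s hs.le).aestronglyMeasurable, (of_continuous ⊤ hc0).memLp, ?_⟩
  intro R
  -- Uniform continuity on this compact set of depths and base points gives uniform convergence on
  -- the ball.
  have hcont : ContinuousOn (fun q : ℝ × E => M (q.2, η q.2 - q.1))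
      (Set.Icc 0 1 ×ˢ Metric.closedBall 0 R) := by
    refine hM.comp (by fun_prop) ?_
    intro q hq
    simpa using hq.1.1
  have hu := (isCompact_Icc.prod (isCompact_closedBall (0 : E) R)).uniformContinuousOn_of_continuous
    hcont
  rw [Metric.uniformContinuousOn_iff] at hu
  rw [ENNReal.tendsto_nhds_zero]
  intro ε hε
  obtain ⟨δ, hδ, hδε⟩ : ∃ δ : ℝ, 0 < δ ∧ ENNReal.ofReal δ ≤ ε := by
    by_cases h : ε = ⊤
    · exact ⟨1, one_pos, by simp [h]⟩
    · exact ⟨ε.toReal, ENNReal.toReal_pos hε.ne' h, (ENNReal.ofReal_toReal h).le⟩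
  obtain ⟨d, hd, H⟩ := hu δ hδ
  have hnear : ∀ᶠ s in 𝓝[>] (0 : ℝ), s < min d 1 :=
    nhdsWithin_le_nhds (gt_mem_nhds (lt_min hd one_pos))
  filter_upwards [hnear, self_mem_nhdsWithin] with s hs hs0
  refine le_trans ?_ hδε
  have hs0' : 0 < s := hs0
  rw [eLpNorm_exponent_top]
  refine eLpNormEssSup_le_of_ae_bound ?_
  filter_upwards [ae_restrict_mem Metric.isOpen_ball.measurableSet] with x hx
  have hx' := Metric.ball_subset_closedBall hx
  have := H (s, x) ⟨⟨hs0'.le, (hs.trans_le (min_le_right _ _)).le⟩, hx'⟩ (0, x)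
    ⟨⟨le_rfl, zero_le_one⟩, hx'⟩ (by
      simp [Prod.dist_eq, abs_of_pos hs0', hs.trans_le (min_le_left _ _), hd])
  simp only [sub_zero] at this
  rw [Real.dist_eq] at this
  simpa using this.le

end TendstoLocLp

/-! ### The divergence theorem up to the surface -/

lemma tendsto_setIntegral_subgraph {η : E → ℝ} (hη : Continuous η) {h : E × ℝ → ℝ}
    (hh : IntegrableOn h (subgraph η)) :
    Tendsto (fun s => ∫ p in subgraph (fun x => η x - s), h p) (𝓝[>] 0)
      (𝓝 (∫ p in subgraph η, h p)) := by
  have hO : ∀ s : ℝ, MeasurableSet (subgraph fun x => η x - s) := fun s =>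
    (isOpen_subgraph (by fun_prop)).measurableSet
  have key : Tendsto (fun s => ∫ p in subgraph η, (subgraph fun x => η x - s).indicator h p)
      (𝓝[>] 0) (𝓝 (∫ p in subgraph η, h p)) := by
    refine tendsto_integral_filter_of_dominated_convergence (fun p => ‖h p‖)
      (Eventually.of_forall fun s => hh.1.indicator (hO s))
      (Eventually.of_forall fun s => ae_of_all _ fun p => norm_indicator_le_norm_self _ _)
      hh.norm ?_
    filter_upwards [ae_restrict_mem (isOpen_subgraph hη).measurableSet] with p hp
    refine tendsto_const_nhds.congr' ?_
    have hp' : 0 < η p.1 - p.2 := sub_pos.2 hp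
    filter_upwards [nhdsWithin_le_nhds (gt_mem_nhds hp')] with s hs
    rw [Set.indicator_of_mem]
    show p.2 < η p.1 - s
    linarith
  refine key.congr' ?_
  filter_upwards [self_mem_nhdsWithin] with s hs
  rw [setIntegral_indicator (hO s)]
  congr 2
  ext p
  have : 0 < s := hs
  simp only [subgraph, Set.mem_inter_iff, Set.mem_ofPred_eq]
  constructor
  · exact fun h => h.2
  · exact fun h => ⟨by linarith, h⟩

/-- The divergence theorem on the subgraph of `η`, for a field which is `C¹` in the interior,
vanishes off a compact set, and has boundary values in the sense of `L¹_loc`. -/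
theorem setIntegral_div_subgraph {A : Type*} [Fintype A] (e : A → E × ℝ) {η : E → ℝ}
    (hη : ContDiff ℝ 1 η) {F : A → E × ℝ → ℝ} (hF : ∀ a, ContDiffOn ℝ 1 (F a) (subgraph η))
    {K : Set (E × ℝ)} (hK : IsCompact K) (hFK : ∀ a, ∀ p ∈ subgraph η, p ∉ K → F a p = 0)
    {G : A → E → ℝ} (hG : ∀ a, TendstoLocLp 1 (fun s x => F a (x, η x - s)) (G a))
    (hint : IntegrableOn (fun p => ∑ a, fderiv ℝ (F a) p (e a)) (subgraph η)) :
    ∫ p in subgraph η, ∑ a, fderiv ℝ (F a) p (e a) =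
      ∫ x, ∑ a, G a x * ((e a).2 - fderiv ℝ η x (e a).1) := by
  have h1 := tendsto_setIntegral_subgraph hη.continuous hint
  have hcη : Continuous fun x => fderiv ℝ η x := hη.continuous_fderiv one_ne_zero
  have hT : TendstoLocLp 1
      (fun s x => ∑ a, F a (x, η x - s) * ((e a).2 - fderiv ℝ η x (e a).1))
      (fun x => ∑ a, G a x * ((e a).2 - fderiv ℝ η x (e a).1)) := by
    refine TendstoLocLp.sum _ le_rfl fun a => ?_
    exact TendstoLocLp.mul (p := 1) (q := ⊤) le_top le_rfl (hG a)
      (TendstoLocLp.of_continuous ⊤ (by fun_prop))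
  obtain ⟨R, hR⟩ := (hK.image continuous_fst).isBounded.subset_ball 0
  have h2 := hT.tendsto_integral (R := R) (by
    intro s hs x hx
    refine Finset.sum_eq_zero fun a _ => ?_
    rw [hFK a, zero_mul]
    · simpa [subgraph] using hs
    · exact fun h => hx (hR ⟨_, h, rfl⟩))
  -- Both sides are limits as `s ↓ 0` of the identity at depth `s`: the interior side by dominated
  -- convergence, the surface side by `L¹_loc` convergence.
  refine tendsto_nhds_unique h1 (h2.congr' ?_)
  filter_upwards [self_mem_nhdsWithin] with s hs
  have hd := fun a => setIntegral_fderiv_subgraph hη (hF a) hK (hFK a) hs (e a)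
  rw [integral_finsetSum _ fun a _ => (hd a).1, integral_finsetSum _ fun a _ => (hd a).2.1]
  exact Finset.sum_congr rfl fun a _ => (hd a).2.2.symm

/-! ### Pointwise divergences of the Rellich and curl fields -/

variable {A : Type*} [Fintype A] [DecidableEq A]

lemma fderiv_sum_coord_mul {e : A → E × ℝ} {ξ : A → (E × ℝ) →L[ℝ] ℝ}
    (hξ : ∀ a b, ξ a (e b) = if a = b then 1 else 0) {u : A → E × ℝ → ℝ} {p : E × ℝ}
    (hu : ∀ a, DifferentiableAt ℝ (u a) p) (a : A) :
    fderiv ℝ (fun q => ∑ b, ξ b q * u b q) p (e a) =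
      u a p + ∑ b, ξ b p * fderiv ℝ (u b) p (e a) := by
  rw [fderiv_fun_sum fun b _ => (ξ b).differentiableAt.fun_mul (hu b)]
  have h : ∀ b, fderiv ℝ (fun q => ξ b q * u b q) p (e a) =
      ξ b p * fderiv ℝ (u b) p (e a) + u b p * (if b = a then 1 else 0) := by
    intro b
    rw [fderiv_fun_mul (ξ b).differentiableAt (hu b), (ξ b).fderiv]
    simp [hξ]
  simp only [sum_apply, h, Finset.sum_add_distrib]
  simp [add_comm]

lemma fderiv_sum_sq {u : A → E × ℝ → ℝ} {p : E × ℝ}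
    (hu : ∀ a, DifferentiableAt ℝ (u a) p) (v : E × ℝ) :
    fderiv ℝ (fun q => ∑ b, u b q ^ 2) p v = 2 * ∑ b, u b p * fderiv ℝ (u b) p v := by
  rw [fderiv_fun_sum fun b _ => (hu b).fun_pow 2, sum_apply, Finset.mul_sum]
  refine Finset.sum_congr rfl fun b _ => ?_
  rw [fderiv_fun_pow 2 (hu b)]
  simp
  ring

/-- The divergence of the Rellich field `χ ((X·u) u - |u|² X / 2)`, for a curl-free and
divergence-free field `u`. -/
lemma div_rellich {e : A → E × ℝ} {ξ : A → (E × ℝ) →L[ℝ] ℝ}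
    (hξ : ∀ a b, ξ a (e b) = if a = b then 1 else 0) {u : A → E × ℝ → ℝ} {χ : E × ℝ → ℝ}
    {p : E × ℝ} (hu : ∀ a, DifferentiableAt ℝ (u a) p) (hχ : DifferentiableAt ℝ χ p)
    (hsymm : ∀ a b, fderiv ℝ (u b) p (e a) = fderiv ℝ (u a) p (e b))
    (hdiv : ∑ a, fderiv ℝ (u a) p (e a) = 0) :
    ∑ a, fderiv ℝ (fun q => χ q * ((∑ b, ξ b q * u b q) * u a q -
        1 / 2 * ((∑ b, u b q ^ 2) * ξ a q))) p (e a) =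
      (1 - (Fintype.card A : ℝ) / 2) * (χ p * ∑ a, u a p ^ 2) +
      (∑ a, fderiv ℝ χ p (e a) * u a p) * (∑ b, ξ b p * u b p) -
      1 / 2 * ((∑ a, u a p ^ 2) * ∑ a, ξ a p * fderiv ℝ χ p (e a)) := by
  have hS : DifferentiableAt ℝ (fun q => ∑ b, ξ b q * u b q) p :=
    DifferentiableAt.fun_sum fun b _ => (ξ b).differentiableAt.mul (hu b)
  have hQ : DifferentiableAt ℝ (fun q => ∑ b, u b q ^ 2) p :=
    DifferentiableAt.fun_sum fun b _ => (hu b).pow 2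
  have key : ∀ a, fderiv ℝ (fun q => χ q * ((∑ b, ξ b q * u b q) * u a q -
        1 / 2 * ((∑ b, u b q ^ 2) * ξ a q))) p (e a) =
      fderiv ℝ χ p (e a) * ((∑ b, ξ b p * u b p) * u a p - 1 / 2 * ((∑ b, u b p ^ 2) * ξ a p)) +
      χ p * ((u a p + ∑ b, ξ b p * fderiv ℝ (u b) p (e a)) * u a p +
        (∑ b, ξ b p * u b p) * fderiv ℝ (u a) p (e a) -
        (∑ b, u b p * fderiv ℝ (u b) p (e a)) * ξ a p - 1 / 2 * (∑ b, u b p ^ 2)) := by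
    intro a
    have h1 : DifferentiableAt ℝ (fun q => (∑ b, ξ b q * u b q) * u a q) p := hS.mul (hu a)
    have h2 : DifferentiableAt ℝ (fun q => (∑ b, u b q ^ 2) * ξ a q) p :=
      hQ.mul (ξ a).differentiableAt
    rw [fderiv_fun_mul hχ (h1.fun_sub (h2.const_mul _)), fderiv_fun_sub h1 (h2.const_mul _),
      fderiv_const_mul h2, fderiv_fun_mul hS (hu a), fderiv_fun_mul hQ (ξ a).differentiableAt,
      (ξ a).fderiv]
    simp only [add_apply, smul_apply, sub_apply, smul_eq_mul, fderiv_sum_coord_mul hξ hu,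
      fderiv_sum_sq hu, hξ, if_true]
    ring
  simp_rw [key]
  -- By symmetry of `Du`, the term from differentiating `X·u` cancels the term from differentiating
  -- `|u|² / 2`.
  have c1 : ∑ a, (∑ b, ξ b p * fderiv ℝ (u b) p (e a)) * u a p =
      ∑ a, (∑ b, u b p * fderiv ℝ (u b) p (e a)) * ξ a p := by
    simp_rw [Finset.sum_mul]
    rw [Finset.sum_comm]
    refine Finset.sum_congr rfl fun a _ => Finset.sum_congr rfl fun b _ => ?_
    rw [hsymm b a]
    ring
  generalize (∑ b, ξ b p * u b p) = S at *
  have expand : ∀ a, fderiv ℝ χ p (e a) * (S * u a p - 1 / 2 * ((∑ b, u b p ^ 2) * ξ a p)) +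
      χ p * ((u a p + ∑ b, ξ b p * fderiv ℝ (u b) p (e a)) * u a p +
        S * fderiv ℝ (u a) p (e a) -
        (∑ b, u b p * fderiv ℝ (u b) p (e a)) * ξ a p - 1 / 2 * (∑ b, u b p ^ 2)) =
      (fderiv ℝ χ p (e a) * u a p) * S -
        1 / 2 * ((∑ b, u b p ^ 2) * (ξ a p * fderiv ℝ χ p (e a))) +
      χ p * (u a p ^ 2) + χ p * ((∑ b, ξ b p * fderiv ℝ (u b) p (e a)) * u a p) +
        χ p * S * fderiv ℝ (u a) p (e a) -
        χ p * ((∑ b, u b p * fderiv ℝ (u b) p (e a)) * ξ a p) -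
          χ p * (1 / 2 * (∑ b, u b p ^ 2)) := by
    intro a
    ring
  simp_rw [expand]
  simp only [Finset.sum_add_distrib, Finset.sum_sub_distrib, ← Finset.mul_sum, ← Finset.sum_mul,
    hdiv, c1, Finset.sum_const, Finset.card_univ, nsmul_eq_mul]
  ring

/-- The field `(X·∇w) c - (c·∇w) X + (n-1) w c` is divergence-free. -/
lemma div_curl {e : A → E × ℝ} {ξ : A → (E × ℝ) →L[ℝ] ℝ}
    (hξ : ∀ a b, ξ a (e b) = if a = b then 1 else 0) {w : E × ℝ → ℝ} {u : A → E × ℝ → ℝ}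
    {p : E × ℝ} (hu : ∀ a, DifferentiableAt ℝ (u a) p) (hw : DifferentiableAt ℝ w p)
    (hwu : ∀ a, fderiv ℝ w p (e a) = u a p)
    (hsymm : ∀ a b, fderiv ℝ (u b) p (e a) = fderiv ℝ (u a) p (e b)) (c : A → ℝ) :
    ∑ a, fderiv ℝ (fun q => (∑ b, ξ b q * u b q) * c a - (∑ b, c b * u b q) * ξ a q +
        ((Fintype.card A : ℝ) - 1) * (w q * c a)) p (e a) = 0 := by
  have hS : DifferentiableAt ℝ (fun q => ∑ b, ξ b q * u b q) p :=
    DifferentiableAt.fun_sum fun b _ => (ξ b).differentiableAt.mul (hu b)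
  have hQ : DifferentiableAt ℝ (fun q => ∑ b, c b * u b q) p :=
    DifferentiableAt.fun_sum fun b _ => (hu b).const_mul _
  have hQd : ∀ a, fderiv ℝ (fun q => ∑ b, c b * u b q) p (e a) =
      ∑ b, c b * fderiv ℝ (u b) p (e a) := by
    intro a
    rw [fderiv_fun_sum fun b _ => (hu b).const_mul _, sum_apply]
    refine Finset.sum_congr rfl fun b _ => ?_
    rw [fderiv_const_mul (hu b)]
    simp
  have key : ∀ a, fderiv ℝ (fun q => (∑ b, ξ b q * u b q) * c a - (∑ b, c b * u b q) * ξ a q +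
        ((Fintype.card A : ℝ) - 1) * (w q * c a)) p (e a) =
      c a * u a p + c a * (∑ b, ξ b p * fderiv ℝ (u b) p (e a)) -
        (∑ b, c b * fderiv ℝ (u b) p (e a)) * ξ a p - (∑ b, c b * u b p) +
        ((Fintype.card A : ℝ) - 1) * (c a * u a p) := by
    intro a
    have h1 : DifferentiableAt ℝ (fun q => (∑ b, ξ b q * u b q) * c a) p := hS.mul_const _
    have h2 : DifferentiableAt ℝ (fun q => (∑ b, c b * u b q) * ξ a q) p :=
      hQ.mul (ξ a).differentiableAt
    have h3 : DifferentiableAt ℝ (fun q => w q * c a) p := hw.mul_const _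
    rw [fderiv_fun_add (h1.fun_sub h2) (h3.const_mul _), fderiv_fun_sub h1 h2,
      fderiv_const_mul h3, fderiv_mul_const hS, fderiv_fun_mul hQ (ξ a).differentiableAt,
      fderiv_mul_const hw, (ξ a).fderiv]
    simp only [add_apply, smul_apply, sub_apply, smul_eq_mul, fderiv_sum_coord_mul hξ hu,
      hQd, hξ, if_true, hwu]
    ring
  simp_rw [key]
  -- Symmetry of `Du` again: the second-order terms cancel, and the first-order ones cancel by the
  -- coefficient `card A - 1`.
  have c1 : ∑ a, c a * (∑ b, ξ b p * fderiv ℝ (u b) p (e a)) =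
      ∑ a, (∑ b, c b * fderiv ℝ (u b) p (e a)) * ξ a p := by
    simp_rw [Finset.sum_mul, Finset.mul_sum]
    rw [Finset.sum_comm]
    refine Finset.sum_congr rfl fun a _ => Finset.sum_congr rfl fun b _ => ?_
    rw [hsymm b a]
    ring
  simp only [Finset.sum_add_distrib, Finset.sum_sub_distrib, ← Finset.mul_sum,
    c1, Finset.sum_const, Finset.card_univ, nsmul_eq_mul]
  ring

/-! ### Localised integral identities for a harmonic potential -/

/-- A harmonic potential `φ` below the graph of `η` with square integrable gradient, whose gradient
has the boundary value `G`, all in terms of a frame `e` with dual coordinates `ξ`. -/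
structure HarmonicBelow (e : A → E × ℝ) (ξ : A → (E × ℝ) →L[ℝ] ℝ) (η : E → ℝ) (φ : E × ℝ → ℝ)
    (G : A → E → ℝ) : Prop where
  dual : ∀ a b, ξ a (e b) = if a = b then 1 else 0
  contDiff : ContDiff ℝ 1 η
  contDiffOn : ContDiffOn ℝ ∞ φ (subgraph η)
  continuousOn : ContinuousOn φ {p | p.2 ≤ η p.1}
  harmonic : ∀ p ∈ subgraph η, ∑ a, fderiv ℝ (fun q => fderiv ℝ φ q (e a)) p (e a) = 0
  boundary : ∀ a, TendstoLocLp 2 (fun s x => fderiv ℝ φ (x, η x - s) (e a)) (G a)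
  memLp : ∀ a, MemLp (fun p => fderiv ℝ φ p (e a)) 2 (volume.restrict (subgraph η))

lemma integrable_mul_mul_of_hasCompactSupport {X : Type*} [TopologicalSpace X] [MeasurableSpace X]
    [OpensMeasurableSpace X] {μ : Measure X} {m : X → ℝ} (hm : Continuous m)
    (hmc : HasCompactSupport m) {f g : X → ℝ} (hf : MemLp f 2 μ) (hg : MemLp g 2 μ) :
    Integrable (fun x => m x * (f x * g x)) μ := by
  obtain ⟨C, hC⟩ := hmc.exists_bound_of_continuous hm
  exact (hf.integrable_mul hg).bdd_mul
    (hm.stronglyMeasurable_of_hasCompactSupport hmc).aestronglyMeasurable (ae_of_all _ hC)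

lemma contDiffOn_fderiv_apply {W : Type*} [NormedAddCommGroup W] [NormedSpace ℝ W] {f : W → ℝ}
    {S : Set W} (hS : IsOpen S) (hf : ContDiffOn ℝ ∞ f S) (v : W) :
    ContDiffOn ℝ ∞ (fun q => fderiv ℝ f q v) S :=
  (hf.fderiv_of_isOpen hS (by simp)).clm_apply contDiffOn_const

/-- This supplies the curl-free hypothesis for gradient fields in `div_rellich` and `div_curl`. -/
lemma fderiv_fderiv_apply_comm {W : Type*} [NormedAddCommGroup W] [NormedSpace ℝ W] {f : W → ℝ}
    {p : W} (hf : ContDiffAt ℝ ∞ f p) (v w : W) :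
    fderiv ℝ (fun q => fderiv ℝ f q v) p w = fderiv ℝ (fun q => fderiv ℝ f q w) p v := by
  have hd : DifferentiableAt ℝ (fderiv ℝ f) p :=
    (hf.fderiv_right (m := 1) (by norm_cast)).differentiableAt one_ne_zero
  have h := (hf.isSymmSndFDerivAt (by simp; exact WithTop.coe_le_coe.2 le_top)).eq v w
  rw [fderiv_clm_apply hd (differentiableAt_const v), fderiv_clm_apply hd (differentiableAt_const w)]
  simpa using h.symm

namespace HarmonicBelow

variable {e : A → E × ℝ} {ξ : A → (E × ℝ) →L[ℝ] ℝ} {η : E → ℝ} {φ : E × ℝ → ℝ} {G : A → E → ℝ}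

lemma isOpen (D : HarmonicBelow e ξ η φ G) : IsOpen (subgraph η) :=
  isOpen_subgraph D.contDiff.continuous

lemma contDiffOn_deriv (D : HarmonicBelow e ξ η φ G) (a : A) :
    ContDiffOn ℝ ∞ (fun q => fderiv ℝ φ q (e a)) (subgraph η) :=
  contDiffOn_fderiv_apply D.isOpen D.contDiffOn _

lemma differentiableAt_deriv (D : HarmonicBelow e ξ η φ G) (a : A) {p : E × ℝ}
    (hp : p ∈ subgraph η) : DifferentiableAt ℝ (fun q => fderiv ℝ φ q (e a)) p :=
  ((D.contDiffOn_deriv a).contDiffAt (D.isOpen.mem_nhds hp)).differentiableAt (by simp)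

/-- The divergence theorem for the Rellich field of `∇φ` times a cutoff. Products of two `L²_loc`
boundary values converge in `L¹_loc`, which is why the quadratic surface terms pass to the limit. -/
theorem integral_rellich (D : HarmonicBelow e ξ η φ G) {χ : E × ℝ → ℝ} (hχ : ContDiff ℝ ∞ χ)
    (hχc : HasCompactSupport χ) :
    ∫ p in subgraph η, ((1 - (Fintype.card A : ℝ) / 2) * (χ p * ∑ a, fderiv ℝ φ p (e a) ^ 2) +
      (∑ a, fderiv ℝ χ p (e a) * fderiv ℝ φ p (e a)) * (∑ b, ξ b p * fderiv ℝ φ p (e b)) -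
      1 / 2 * ((∑ a, fderiv ℝ φ p (e a) ^ 2) * ∑ a, ξ a p * fderiv ℝ χ p (e a))) =
    ∫ x, ∑ a, (χ (x, η x) * ((∑ b, ξ b (x, η x) * G b x) * G a x -
      1 / 2 * ((∑ b, G b x ^ 2) * ξ a (x, η x)))) * ((e a).2 - fderiv ℝ η x (e a).1) := by
  set u : A → E × ℝ → ℝ := fun a q => fderiv ℝ φ q (e a) with hu
  have hηc : Continuous η := D.contDiff.continuous
  have hdiv : ∀ p ∈ subgraph η, _ := fun p hp =>
    div_rellich D.dual (u := u) (χ := χ) (fun a => D.differentiableAt_deriv a hp)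
      (hχ.differentiable (by simp) p)
      (fun a b => fderiv_fderiv_apply_comm (D.contDiffOn.contDiffAt (D.isOpen.mem_nhds hp)) _ _)
      (D.harmonic p hp)
  rw [← setIntegral_congr_fun D.isOpen.measurableSet hdiv]
  have hb : ∀ a, TendstoLocLp 2 (fun s x => u a (x, η x - s)) (G a) := D.boundary
  have hc : ∀ {M : E × ℝ → ℝ}, Continuous M →
      TendstoLocLp ⊤ (fun s x => M (x, η x - s)) (fun x => M (x, η x)) := fun hM =>
    TendstoLocLp.of_continuousOn hηc hM.continuousOn
  have h12 : (1 : ENNReal) ≤ 2 := one_le_two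
  refine setIntegral_div_subgraph e D.contDiff (K := tsupport χ) ?_ hχc.isCompact ?_ ?_ ?_
  · intro a
    have hu1 : ∀ a, ContDiffOn ℝ 1 (u a) (subgraph η) := fun a =>
      (D.contDiffOn_deriv a).of_le (by norm_cast)
    have hξ1 : ∀ a, ContDiffOn ℝ 1 (ξ a) (subgraph η) := fun a => (ξ a).contDiff.contDiffOn
    have hχ1 : ContDiffOn ℝ 1 χ (subgraph η) := (hχ.of_le (by norm_cast)).contDiffOn
    exact hχ1.mul (((ContDiffOn.sum fun b _ => (hξ1 b).mul (hu1 b)).mul (hu1 a)).sub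
      (contDiffOn_const.mul ((ContDiffOn.sum fun b _ => (hu1 b).pow 2).mul (hξ1 a))))
  · intro a p _ hp
    simp only [image_eq_zero_of_notMem_tsupport hp, zero_mul]
  · intro a
    refine TendstoLocLp.mul (p := ⊤) (q := 1) le_rfl le_rfl (hc hχ.continuous) ?_
    refine TendstoLocLp.sub le_rfl ?_ (TendstoLocLp.const_mul ?_ _)
    · refine TendstoLocLp.mul (p := 2) (q := 2) h12 le_rfl (TendstoLocLp.sum _ h12 fun b => ?_)
        (hb a)
      exact TendstoLocLp.mul (p := ⊤) (q := 2) h12 h12 (hc (ξ b).continuous) (hb b)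
    · refine TendstoLocLp.mul (p := 1) (q := ⊤) le_top le_rfl (TendstoLocLp.sum _ le_rfl fun b => ?_)
        (hc (ξ a).continuous)
      simp_rw [sq]
      exact TendstoLocLp.mul (p := 2) (q := 2) h12 le_rfl (hb b) (hb b)
  · refine IntegrableOn.congr_fun ?_ (fun p hp => (hdiv p hp).symm) D.isOpen.measurableSet
    have hcd : Continuous fun p => fderiv ℝ χ p := hχ.continuous_fderiv (by simp)
    refine Integrable.sub (Integrable.add (Integrable.const_mul ?_ _) ?_)
      (Integrable.const_mul ?_ _)
    · simp_rw [Finset.mul_sum, sq]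
      exact integrable_finsetSum _ fun a _ =>
        integrable_mul_mul_of_hasCompactSupport hχ.continuous hχc (D.memLp a) (D.memLp a)
    · simp_rw [Finset.sum_mul_sum]
      refine integrable_finsetSum _ fun a _ => integrable_finsetSum _ fun b _ => ?_
      have := integrable_mul_mul_of_hasCompactSupport (m := fun p => fderiv ℝ χ p (e a) * ξ b p)
        (by fun_prop) (hχc.fderiv_apply ℝ (e a)).mul_right (D.memLp a) (D.memLp b)
      refine this.congr (ae_of_all _ fun p => ?_)
      simp only [hu]
      ring
    · simp_rw [Finset.sum_mul_sum]
      refine integrable_finsetSum _ fun a _ => integrable_finsetSum _ fun b _ => ?_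
      have := integrable_mul_mul_of_hasCompactSupport (m := fun p => ξ b p * fderiv ℝ χ p (e b))
        (by fun_prop) (hχc.fderiv_apply ℝ (e b)).mul_left (D.memLp a) (D.memLp a)
      refine this.congr (ae_of_all _ fun p => ?_)
      simp only [hu]
      ring

/-- The cutoff is placed inside the potential. The field built from `χφ` is still exactly
divergence-free, since `div_curl` does not use harmonicity, so no interior error term appears. -/
theorem integral_curl (D : HarmonicBelow e ξ η φ G) {χ : E × ℝ → ℝ} (hχ : ContDiff ℝ ∞ χ)
    (hχc : HasCompactSupport χ) (c : A → ℝ) :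
    ∫ x, ∑ a,
      ((∑ b, ξ b (x, η x) * (χ (x, η x) * G b x + φ (x, η x) * fderiv ℝ χ (x, η x) (e b))) * c a -
       (∑ b, c b * (χ (x, η x) * G b x + φ (x, η x) * fderiv ℝ χ (x, η x) (e b))) * ξ a (x, η x) +
       ((Fintype.card A : ℝ) - 1) * (χ (x, η x) * φ (x, η x) * c a)) *
        ((e a).2 - fderiv ℝ η x (e a).1) = 0 := by
  set w : E × ℝ → ℝ := fun q => χ q * φ q with hw
  have hwd : ContDiffOn ℝ ∞ w (subgraph η) := hχ.contDiffOn.mul D.contDiffOn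
  set u : A → E × ℝ → ℝ := fun a q => fderiv ℝ w q (e a) with hu
  have hηc : Continuous η := D.contDiff.continuous
  have hud : ∀ a, ContDiffOn ℝ ∞ (u a) (subgraph η) := fun a =>
    contDiffOn_fderiv_apply D.isOpen hwd _
  have hue : ∀ a, ∀ p ∈ subgraph η,
      u a p = χ p * fderiv ℝ φ p (e a) + φ p * fderiv ℝ χ p (e a) := by
    intro a p hp
    have := fderiv_fun_mul (hχ.differentiable (by simp) p)
      ((D.contDiffOn.contDiffAt (D.isOpen.mem_nhds hp)).differentiableAt (by simp))
    simp only [hu, hw, this]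
    simp
  have hdiv : ∀ p ∈ subgraph η, _ := fun p hp =>
    div_curl D.dual (u := u) (w := w)
      (fun a => ((hud a).contDiffAt (D.isOpen.mem_nhds hp)).differentiableAt (by simp))
      ((hwd.contDiffAt (D.isOpen.mem_nhds hp)).differentiableAt (by simp)) (fun a => rfl)
      (fun a b => fderiv_fderiv_apply_comm (hwd.contDiffAt (D.isOpen.mem_nhds hp)) _ _) c
  have h12 : (1 : ENNReal) ≤ 2 := one_le_two
  have hc : ∀ {M : E × ℝ → ℝ}, Continuous M →
      TendstoLocLp ⊤ (fun s x => M (x, η x - s)) (fun x => M (x, η x)) := fun hM =>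
    TendstoLocLp.of_continuousOn hηc hM.continuousOn
  have hφ := TendstoLocLp.of_continuousOn hηc D.continuousOn
  have hcd : Continuous fun p => fderiv ℝ χ p := hχ.continuous_fderiv (by simp)
  -- Multiplying by the constant `1` in `L²_loc` turns `L²_loc` convergence into `L¹_loc`
  -- convergence.
  have hone : TendstoLocLp 2 (fun _ _ => (1 : ℝ)) (fun _ : E => 1) :=
    TendstoLocLp.of_continuous 2 continuous_const
  have hb2 : ∀ a, TendstoLocLp 2 (fun s x => u a (x, η x - s))
      (fun x => χ (x, η x) * G a x + φ (x, η x) * fderiv ℝ χ (x, η x) (e a)) := by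
    intro a
    have h1 : TendstoLocLp 2 (fun s x => χ (x, η x - s) * fderiv ℝ φ (x, η x - s) (e a) +
        φ (x, η x - s) * (fderiv ℝ χ (x, η x - s) (e a) * 1))
        (fun x => χ (x, η x) * G a x + φ (x, η x) * (fderiv ℝ χ (x, η x) (e a) * 1)) := by
      refine TendstoLocLp.add h12 ?_ ?_
      · exact TendstoLocLp.mul (p := ⊤) (q := 2) h12 h12 (hc hχ.continuous) (D.boundary a)
      · refine TendstoLocLp.mul (p := ⊤) (q := 2) h12 h12 hφ ?_
        exact TendstoLocLp.mul (p := ⊤) (q := 2) h12 h12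
          (hc (M := fun p => fderiv ℝ χ p (e a)) (by fun_prop)) hone
    simp only [mul_one] at h1
    have hmem : ∀ s : ℝ, 0 < s → ∀ x : E, (x, η x - s) ∈ subgraph η := fun s hs x => by
      simpa [subgraph] using hs
    constructor
    · intro s hs
      refine (h1.aestronglyMeasurable s hs).congr (ae_of_all _ fun x => ?_)
      exact (hue a _ (hmem s hs x)).symm
    · exact h1.memLp
    · intro R
      refine (h1.tendsto R).congr' ?_
      filter_upwards [self_mem_nhdsWithin] with s hs
      congr 1
      ext x
      simp only [Pi.sub_apply, hue a _ (hmem s hs x)]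
  have hb1 : ∀ a, TendstoLocLp 1 (fun s x => u a (x, η x - s))
      (fun x => χ (x, η x) * G a x + φ (x, η x) * fderiv ℝ χ (x, η x) (e a)) := by
    intro a
    simpa using TendstoLocLp.mul (p := 2) (q := 2) h12 le_rfl (hb2 a) hone
  rw [← setIntegral_div_subgraph e D.contDiff (K := tsupport χ) (F := fun a q =>
    (∑ b, ξ b q * u b q) * c a - (∑ b, c b * u b q) * ξ a q +
        ((Fintype.card A : ℝ) - 1) * (w q * c a)) ?_ hχc.isCompact ?_ ?_ ?_]
  · rw [setIntegral_congr_fun D.isOpen.measurableSet hdiv]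
    simp
  · intro a
    have hu1 : ∀ a, ContDiffOn ℝ 1 (u a) (subgraph η) := fun a =>
      (hud a).of_le (by norm_cast)
    have hξ1 : ∀ a, ContDiffOn ℝ 1 (ξ a) (subgraph η) := fun a => (ξ a).contDiff.contDiffOn
    have hw1 : ContDiffOn ℝ 1 w (subgraph η) := hwd.of_le (by norm_cast)
    exact (((ContDiffOn.sum fun b _ => (hξ1 b).mul (hu1 b)).mul contDiffOn_const).sub
      ((ContDiffOn.sum fun b _ => contDiffOn_const.mul (hu1 b)).mul (hξ1 a))).add
      (contDiffOn_const.mul (hw1.mul contDiffOn_const))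
  · intro a p hp hpK
    have hu0 : ∀ b, u b p = 0 := by
      intro b
      rw [hue b p hp, image_eq_zero_of_notMem_tsupport hpK,
        image_eq_zero_of_notMem_tsupport (fun h => hpK (tsupport_fderiv_subset ℝ h))]
      simp
    simp [hu0, hw, image_eq_zero_of_notMem_tsupport hpK]
  · intro a
    have hct : ∀ (r : ℝ), TendstoLocLp ⊤ (fun _ _ => r) (fun _ : E => r) := fun r =>
      TendstoLocLp.of_continuous ⊤ continuous_const
    refine TendstoLocLp.add le_rfl (TendstoLocLp.sub le_rfl ?_ ?_) (TendstoLocLp.const_mul ?_ _)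
    · refine TendstoLocLp.mul (p := 1) (q := ⊤) le_top le_rfl (TendstoLocLp.sum _ le_rfl fun b => ?_)
        (hct _)
      exact TendstoLocLp.mul (p := ⊤) (q := 1) le_rfl le_rfl (hc (ξ b).continuous) (hb1 b)
    · refine TendstoLocLp.mul (p := 1) (q := ⊤) le_top le_rfl (TendstoLocLp.sum _ le_rfl fun b => ?_)
        (hc (ξ a).continuous)
      exact TendstoLocLp.const_mul (hb1 b) _
    · refine TendstoLocLp.mul (p := ⊤) (q := 1) le_rfl le_rfl
        (TendstoLocLp.mul (p := ⊤) (q := ⊤) le_top le_top (hc hχ.continuous) hφ)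
        (TendstoLocLp.of_continuous 1 continuous_const)
  · refine IntegrableOn.congr_fun integrableOn_zero (fun p hp => (hdiv p hp).symm)
      D.isOpen.measurableSet

/-- This is the flux of `T(φ)∇φ`. When `T` vanishes near zero and `φ` decays, that field vanishes
off a compact set without any spatial cutoff. -/
theorem integral_green (D : HarmonicBelow e ξ η φ G) {T : ℝ → ℝ} (hT : ContDiff ℝ ∞ T)
    {C : ℝ} (hTC : ∀ t, |deriv T t| ≤ C) {K : Set (E × ℝ)} (hK : IsCompact K)
    (hTK : ∀ p ∈ subgraph η, p ∉ K → T (φ p) = 0) :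
    ∫ p in subgraph η, deriv T (φ p) * ∑ a, fderiv ℝ φ p (e a) ^ 2 =
      ∫ x, ∑ a, T (φ (x, η x)) * G a x * ((e a).2 - fderiv ℝ η x (e a).1) := by
  have hηc : Continuous η := D.contDiff.continuous
  have hdiv : ∀ p ∈ subgraph η, ∑ a, fderiv ℝ (fun q => T (φ q) * fderiv ℝ φ q (e a)) p (e a) =
      deriv T (φ p) * ∑ a, fderiv ℝ φ p (e a) ^ 2 := by
    intro p hp
    have hφd : DifferentiableAt ℝ φ p :=
      (D.contDiffOn.contDiffAt (D.isOpen.mem_nhds hp)).differentiableAt (by simp)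
    have hTd : HasFDerivAt (fun q => T (φ q)) (deriv T (φ p) • fderiv ℝ φ p) p :=
      (hT.differentiable (by simp) (φ p)).hasDerivAt.comp_hasFDerivAt p hφd.hasFDerivAt
    have h1 : ∀ a, fderiv ℝ (fun q => T (φ q) * fderiv ℝ φ q (e a)) p (e a) =
        T (φ p) * fderiv ℝ (fun q => fderiv ℝ φ q (e a)) p (e a) +
          deriv T (φ p) * fderiv ℝ φ p (e a) ^ 2 := by
      intro a
      rw [fderiv_fun_mul hTd.differentiableAt (D.differentiableAt_deriv a hp), hTd.fderiv]
      simp only [add_apply, smul_apply, smul_eq_mul]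
      ring
    simp_rw [h1]
    rw [Finset.sum_add_distrib, ← Finset.mul_sum, D.harmonic p hp, Finset.mul_sum]
    ring
  rw [← setIntegral_congr_fun D.isOpen.measurableSet hdiv]
  refine setIntegral_div_subgraph e D.contDiff ?_ hK ?_ ?_ ?_
  · intro a
    exact ((hT.comp_contDiffOn D.contDiffOn).mul (D.contDiffOn_deriv a)).of_le (by norm_cast)
  · intro a p hp hpK
    rw [hTK p hp hpK, zero_mul]
  · intro a
    have h1 := TendstoLocLp.of_continuousOn (M := fun p => T (φ p)) hηc
      (hT.continuous.comp_continuousOn D.continuousOn)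
    have hone : TendstoLocLp 2 (fun _ _ => (1 : ℝ)) (fun _ : E => 1) :=
      TendstoLocLp.of_continuous 2 continuous_const
    have h2 := TendstoLocLp.mul (p := 2) (q := 2) (r := 1) one_le_two le_rfl (D.boundary a) hone
    simp only [mul_one] at h2
    exact TendstoLocLp.mul (p := ⊤) (q := 1) le_rfl le_rfl h1 h2
  · refine IntegrableOn.congr_fun ?_ (fun p hp => (hdiv p hp).symm) D.isOpen.measurableSet
    refine Integrable.bdd_mul (c := C) (integrable_finsetSum _ fun a _ => (D.memLp a).integrable_sq)
      ?_ (ae_of_all _ fun p => hTC _)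
    refine ContinuousOn.aestronglyMeasurable ?_ D.isOpen.measurableSet
    exact (hT.continuous_deriv (by simp)).comp_continuousOn D.contDiffOn.continuousOn

/-- The trace of `φ` on the graph has the weak gradient obtained from the boundary value of the
gradient by the chain rule. -/
theorem integral_trace_mul_fderiv (D : HarmonicBelow e ξ η φ G)
    (hspan : ∀ p : E × ℝ, ∑ a, ξ a p • e a = p) {ζ : E → ℝ} (hζ : ContDiff ℝ 1 ζ)
    (hζc : HasCompactSupport ζ) (v : E) :
    ∫ x, φ (x, η x) * fderiv ℝ ζ x v =
      -∫ x, (∑ a, ξ a (v, fderiv ℝ η x v) * G a x) * ζ x := by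
  have hηc : Continuous η := D.contDiff.continuous
  have hcη : Continuous fun x => fderiv ℝ η x := D.contDiff.continuous_fderiv one_ne_zero
  have hcζ : Continuous fun x => fderiv ℝ ζ x := hζ.continuous_fderiv one_ne_zero
  obtain ⟨R, hR⟩ := hζc.isCompact.isBounded.subset_ball 0
  have hζ0 : ∀ x, x ∉ Metric.ball (0 : E) R → ζ x = 0 := fun x hx =>
    image_eq_zero_of_notMem_tsupport fun h => hx (hR h)
  have hζ0' : ∀ x, x ∉ Metric.ball (0 : E) R → fderiv ℝ ζ x = 0 := fun x hx =>
    image_eq_zero_of_notMem_tsupport fun h => hx (hR (tsupport_fderiv_subset ℝ h))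
  have h12 : (1 : ENNReal) ≤ 2 := one_le_two
  have hL : TendstoLocLp 1 (fun s x => φ (x, η x - s) * fderiv ℝ ζ x v)
      (fun x => φ (x, η x) * fderiv ℝ ζ x v) :=
    TendstoLocLp.mul (p := ⊤) (q := 1) le_rfl le_rfl
      (TendstoLocLp.of_continuousOn hηc D.continuousOn)
      (TendstoLocLp.of_continuous 1 (by fun_prop))
  have hRt : TendstoLocLp 1 (fun s x => (∑ a, ξ a (v, fderiv ℝ η x v) *
      fderiv ℝ φ (x, η x - s) (e a)) * ζ x)
      (fun x => (∑ a, ξ a (v, fderiv ℝ η x v) * G a x) * ζ x) := by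
    refine TendstoLocLp.mul (p := 2) (q := 2) h12 le_rfl (TendstoLocLp.sum _ h12 fun a => ?_)
      (TendstoLocLp.of_continuous 2 hζ.continuous)
    exact TendstoLocLp.mul (p := ⊤) (q := 2) h12 h12
      (TendstoLocLp.of_continuous ⊤ (by fun_prop)) (D.boundary a)
  have tL := hL.tendsto_integral (R := R) (by
    intro s _ x hx
    simp [hζ0' x hx])
  have tR := (hRt.tendsto_integral (R := R) (by
    intro s _ x hx
    simp [hζ0 x hx])).neg
  -- At depth `s > 0` the trace is classically `C¹`, so ordinary integration by parts and the chain
  -- rule apply; the claim is the limit `s ↓ 0`.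
  refine tendsto_nhds_unique tL (tR.congr' ?_)
  filter_upwards [self_mem_nhdsWithin] with s hs
  have hmem : ∀ x : E, (x, η x - s) ∈ subgraph η := fun x => by
    simpa [subgraph] using hs
  have hψ : ContDiff ℝ 1 fun x => φ (x, η x - s) := by
    have := D.contDiff
    exact (D.contDiffOn.of_le (by norm_cast)).comp_contDiff (by fun_prop) hmem
  have hψd : ∀ x, fderiv ℝ (fun x => φ (x, η x - s)) x v =
      ∑ a, ξ a (v, fderiv ℝ η x v) * fderiv ℝ φ (x, η x - s) (e a) := by
    intro x
    have h1 : HasFDerivAt (fun x : E => (x, η x - s))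
        ((ContinuousLinearMap.id ℝ E).prod (fderiv ℝ η x)) x :=
      (hasFDerivAt_id x).prodMk ((D.contDiff.differentiable one_ne_zero x).hasFDerivAt.sub_const s)
    have h2 := (((D.contDiffOn.contDiffAt (D.isOpen.mem_nhds (hmem x))).differentiableAt
      (by simp)).hasFDerivAt).comp x h1
    have h3 : fderiv ℝ (fun x => φ (x, η x - s)) x = _ := h2.fderiv
    rw [h3]
    have h4 := congrArg (fderiv ℝ φ (x, η x - s)) (hspan (v, fderiv ℝ η x v))
    simp only [map_sum, map_smul, smul_eq_mul] at h4
    exact h4.symm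
  have hcψ := hψ.continuous_fderiv one_ne_zero
  have hcψ0 := hψ.continuous
  have := integral_mul_fderiv_eq_neg_fderiv_mul_of_integrable (μ := (volume : Measure E))
    (f := fun x => φ (x, η x - s)) (g := ζ) (v := v)
    (Continuous.integrable_of_hasCompactSupport
      ((hcψ.clm_apply continuous_const).mul hζ.continuous) hζc.mul_left)
    (Continuous.integrable_of_hasCompactSupport
      (hcψ0.mul (hcζ.clm_apply continuous_const)) (hζc.fderiv_apply ℝ v).mul_left)
    (Continuous.integrable_of_hasCompactSupport (hcψ0.mul hζ.continuous) hζc.mul_left)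
    (fun x _ => hψ.differentiable one_ne_zero x) (fun x _ => hζ.differentiable one_ne_zero x)
  rw [this]
  simp_rw [hψd]

end HarmonicBelow

/-! ### Cutoffs, truncations and the zero set of a differentiable function -/

/-- A family of smooth cutoff functions at scale `R`, with scale invariant bounds. -/
structure IsCutoffFamily {V : Type*} [NormedAddCommGroup V] [NormedSpace ℝ V]
    (χ : ℝ → V → ℝ) (C : ℝ) : Prop where
  contDiff : ∀ R, ContDiff ℝ ∞ (χ R)
  hasCompactSupport : ∀ R, 0 < R → HasCompactSupport (χ R)
  abs_le_one : ∀ R p, |χ R p| ≤ 1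
  norm_fderiv_le : ∀ R p, 0 < R → ‖fderiv ℝ (χ R) p‖ ≤ C / R
  norm_fderiv_mul_le : ∀ R p, 0 < R → ‖fderiv ℝ (χ R) p‖ * ‖p‖ ≤ C
  eq_one : ∀ R p, 0 < R → ‖p‖ ≤ R → χ R p = 1
  fderiv_eq_zero_of_lt : ∀ R p, 0 < R → ‖p‖ < R → fderiv ℝ (χ R) p = 0
  eq_zero : ∀ R p, 0 < R → 2 * R ≤ ‖p‖ → χ R p = 0
  fderiv_eq_zero_of_gt : ∀ R p, 0 < R → 2 * R < ‖p‖ → fderiv ℝ (χ R) p = 0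

/-- One bump function is rescaled. If `M` bounds its derivative, the scaled derivative is at most `M
/ R` and lives where `‖p‖ ≤ 2R`, hence the constant `2M` serves for both bounds. -/
lemma exists_isCutoffFamily (V : Type*) [NormedAddCommGroup V] [NormedSpace ℝ V]
    [FiniteDimensional ℝ V] : ∃ (χ : ℝ → V → ℝ) (C : ℝ), 0 ≤ C ∧ IsCutoffFamily χ C := by
  let b : ContDiffBump (0 : V) := ⟨1, 2, one_pos, one_lt_two⟩
  have hb : ContDiff ℝ ∞ b := b.contDiff
  obtain ⟨M, hM⟩ := b.hasCompactSupport.fderiv ℝ |>.exists_bound_of_continuous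
    (hb.continuous_fderiv (by simp))
  have hM0 : 0 ≤ M := (norm_nonneg _).trans (hM 0)
  have hz : ∀ p, p ∉ Metric.closedBall (0 : V) 2 → fderiv ℝ b p = 0 := by
    intro p hp
    refine image_eq_zero_of_notMem_tsupport fun h => hp ?_
    have := tsupport_fderiv_subset ℝ h
    rwa [b.tsupport_eq] at this
  have hder : ∀ (R : ℝ) (p : V), fderiv ℝ (fun p => b (R⁻¹ • p)) p = R⁻¹ • fderiv ℝ b (R⁻¹ • p) := by
    intro R p
    exact fderiv_comp_smul (f := b) R⁻¹
  have hn : ∀ (R : ℝ) (p : V), 0 < R → ‖R⁻¹ • p‖ = ‖p‖ / R := by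
    intro R p hR
    rw [norm_smul, norm_inv, Real.norm_of_nonneg hR.le]
    field_simp
  have hcd : ∀ R : ℝ, ContDiff ℝ ∞ fun p => b (R⁻¹ • p) := fun R =>
    hb.comp (contDiff_const_smul (R⁻¹ : ℝ))
  have hone : ∀ (R : ℝ) (p : V), 0 < R → ‖p‖ ≤ R → b (R⁻¹ • p) = 1 := by
    intro R p hR hp
    refine b.one_of_mem_closedBall ?_
    rw [mem_closedBall_zero_iff, hn R p hR]
    exact (div_le_one hR).2 hp
  have hzero : ∀ (R : ℝ) (p : V), 0 < R → 2 * R ≤ ‖p‖ → b (R⁻¹ • p) = 0 := by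
    intro R p hR hp
    refine b.zero_of_le_dist ?_
    rw [dist_zero_right, hn R p hR]
    exact (le_div_iff₀ hR).2 hp
  refine ⟨fun R p => b (R⁻¹ • p), 2 * M, by positivity, hcd, ?_, ?_, ?_, ?_, hone, ?_, hzero, ?_⟩
  · intro R hR
    refine HasCompactSupport.of_support_subset_isCompact (isCompact_closedBall (0 : V) (2 * R)) ?_
    intro p hp
    rw [mem_closedBall_zero_iff]
    by_contra h
    exact hp (hzero R p hR (not_le.1 h).le)
  · intro R p
    rw [abs_of_nonneg b.nonneg]
    exact b.le_one
  · intro R p hR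
    rw [hder, norm_smul, norm_inv, Real.norm_of_nonneg hR.le, div_eq_inv_mul]
    have := hM (R⁻¹ • p)
    gcongr
    linarith
  · intro R p hR
    rw [hder, norm_smul, norm_inv, Real.norm_of_nonneg hR.le]
    by_cases h : R⁻¹ • p ∈ Metric.closedBall (0 : V) 2
    · rw [mem_closedBall_zero_iff, hn R p hR] at h
      calc R⁻¹ * ‖fderiv ℝ b (R⁻¹ • p)‖ * ‖p‖ = ‖fderiv ℝ b (R⁻¹ • p)‖ * (‖p‖ / R) := by
            field_simp
        _ ≤ M * 2 := by
            gcongr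
            exact hM _
        _ = 2 * M := by ring
    · rw [hz _ h]
      simp [hM0]
  · intro R p hR hp
    have : (fun p => b (R⁻¹ • p)) =ᶠ[𝓝 p] fun _ => 1 := by
      have ho : {q : V | ‖q‖ < R} ∈ 𝓝 p := (isOpen_lt continuous_norm continuous_const).mem_nhds hp
      filter_upwards [ho] with q hq
      exact hone R q hR (le_of_lt hq)
    rw [this.fderiv_eq]
    simp
  · intro R p hR hp
    rw [hder, hz, smul_zero]
    rw [mem_closedBall_zero_iff, hn R p hR, not_le]
    exact (lt_div_iff₀ hR).2 hp

lemma IsCutoffFamily.eventually {V : Type*} [NormedAddCommGroup V] [NormedSpace ℝ V]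
    {χ : ℝ → V → ℝ} {C : ℝ} (h : IsCutoffFamily χ C) (p : V) :
    ∀ᶠ k : ℕ in atTop, χ (k + 1) p = 1 ∧ fderiv ℝ (χ (k + 1)) p = 0 := by
  obtain ⟨N, hN⟩ := exists_nat_gt ‖p‖
  filter_upwards [eventually_ge_atTop N] with k hk
  have hk' : (N : ℝ) ≤ k := by exact_mod_cast hk
  have hlt : ‖p‖ < (k : ℝ) + 1 := by linarith
  exact ⟨h.eq_one _ _ (by positivity) hlt.le, h.fderiv_eq_zero_of_lt _ _ (by positivity) hlt⟩

/-- Smooth truncations of the identity which vanish near `0`. -/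
lemma exists_truncation : ∃ (T : ℕ → ℝ → ℝ) (C : ℝ), (∀ k, ContDiff ℝ ∞ (T k)) ∧
    (∀ k t, |deriv (T k) t| ≤ C) ∧ (∀ k t, |T k t| ≤ C * |t|) ∧
    (∀ k, ∃ ε : ℝ, 0 < ε ∧ ∀ t, |t| < ε → T k t = 0) ∧
    (∀ t, ∀ᶠ k in atTop, T k t = t) ∧ (∀ t, t ≠ 0 → ∀ᶠ k in atTop, deriv (T k) t = 1) := by
  obtain ⟨χ, C, hC0, hχ⟩ := exists_isCutoffFamily ℝ
  have hR : ∀ k : ℕ, (0 : ℝ) < 1 / ((k : ℝ) + 1) := fun k => by positivity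
  have hd : ∀ (k : ℕ) (t : ℝ), HasDerivAt (fun t => t * (1 - χ (1 / ((k : ℝ) + 1)) t))
      (1 - χ (1 / ((k : ℝ) + 1)) t - t * fderiv ℝ (χ (1 / ((k : ℝ) + 1))) t 1) t := by
    intro k t
    have h1 : HasDerivAt (χ (1 / ((k : ℝ) + 1))) (fderiv ℝ (χ (1 / ((k : ℝ) + 1))) t 1) t :=
      ((hχ.contDiff _).differentiable (by simp) t).hasFDerivAt.hasDerivAt
    convert! (hasDerivAt_id t).mul ((hasDerivAt_const t (1 : ℝ)).sub h1) using 1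
    simp
    ring
  have hev : ∀ t : ℝ, t ≠ 0 → ∀ᶠ k : ℕ in atTop, χ (1 / ((k : ℝ) + 1)) t = 0 ∧
      fderiv ℝ (χ (1 / ((k : ℝ) + 1))) t = 0 := by
    intro t ht
    have h1 : Tendsto (fun k : ℕ => 2 * (1 / ((k : ℝ) + 1))) atTop (𝓝 (2 * 0)) :=
      tendsto_one_div_add_atTop_nhds_zero_nat.const_mul 2
    rw [mul_zero] at h1
    filter_upwards [h1.eventually (gt_mem_nhds (norm_pos_iff.2 ht))] with k hk
    exact ⟨hχ.eq_zero _ _ (hR k) hk.le, hχ.fderiv_eq_zero_of_gt _ _ (hR k) hk⟩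
  -- The derivative is `1 - χ - tχ'`, with `|1 - χ| ≤ 2` and `|tχ'| ≤ C`, whence `2 + C`.
  refine ⟨fun k t => t * (1 - χ (1 / ((k : ℝ) + 1)) t), 2 + C, ?_, ?_, ?_, ?_, ?_, ?_⟩
  · intro k
    have := hχ.contDiff (1 / ((k : ℝ) + 1))
    exact contDiff_id.mul (contDiff_const.sub this)
  · intro k t
    rw [(hd k t).deriv]
    have h1 := hχ.abs_le_one (1 / ((k : ℝ) + 1)) t
    have h2 := hχ.norm_fderiv_mul_le (1 / ((k : ℝ) + 1)) t (hR k)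
    have h3 : |t * fderiv ℝ (χ (1 / ((k : ℝ) + 1))) t 1| ≤ C := by
      refine le_trans ?_ h2
      rw [abs_mul, mul_comm]
      have := (fderiv ℝ (χ (1 / ((k : ℝ) + 1))) t).le_opNorm 1
      simp only [norm_one, mul_one] at this
      exact mul_le_mul_of_nonneg_right this (abs_nonneg t)
    rw [abs_le] at *
    constructor <;> linarith
  · intro k t
    rw [abs_mul, mul_comm]
    have h1 := hχ.abs_le_one (1 / ((k : ℝ) + 1)) t
    have h2 : |1 - χ (1 / ((k : ℝ) + 1)) t| ≤ 2 + C := by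
      rw [abs_le] at *
      constructor <;> linarith
    exact mul_le_mul_of_nonneg_right h2 (abs_nonneg t)
  · intro k
    refine ⟨1 / ((k : ℝ) + 1), hR k, fun t ht => ?_⟩
    simp only [hχ.eq_one _ t (hR k) ht.le, sub_self, mul_zero]
  · intro t
    by_cases ht : t = 0
    · simp [ht]
    · filter_upwards [hev t ht] with k hk
      simp only [hk.1, sub_zero, mul_one]
  · intro t ht
    filter_upwards [hev t ht] with k hk
    rw [(hd k t).deriv, hk.1, hk.2]
    simp

/-- On the zero set of a differentiable function its derivative vanishes almost everywhere. -/
lemma ae_fderiv_apply_eq_zero_of_eq_zero {W : Type*} [NormedAddCommGroup W] [NormedSpace ℝ W]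
    [FiniteDimensional ℝ W] [MeasurableSpace W] [BorelSpace W] (ν : Measure W)
    [ν.IsAddHaarMeasure] {Ω : Set W} (hΩ : IsOpen Ω) {f : W → ℝ} (hf : DifferentiableOn ℝ f Ω)
    (v : W) : ∀ᵐ p ∂ν, p ∈ Ω → f p = 0 → fderiv ℝ f p v = 0 := by
  set N : Set W := Ω ∩ {p | Ω.indicator f p = 0} ∩ {p | fderiv ℝ f p v ≠ 0} with hN
  have hmeas : MeasurableSet N := by
    classical
    have h1 : Measurable (Ω.indicator f) := by
      rw [← Set.piecewise_eq_indicator]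
      exact hf.continuousOn.measurable_piecewise continuousOn_const hΩ.measurableSet
    have h2 : Measurable fun p => fderiv ℝ f p v := measurable_fderiv_apply_const ℝ f v
    exact (hΩ.measurableSet.inter (h1 (measurableSet_singleton 0))).inter
      (h2 (measurableSet_singleton 0).compl)
  have key : ∀ᵐ p ∂ν, p ∈ Nᶜ := by
    -- By Fubini it is enough that each line parallel to `v` meets `N` in a null set. There the
    -- restriction of `f` has nonzero derivative at its zeros, so these are isolated, hence
    -- countable.
    refine ae_mem_of_ae_add_linearMap_mem (LinearMap.toSpanSingleton ℝ W v) volume ν hmeas.compl ?_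
    intro y
    set S : Set ℝ := {t | y + t • v ∈ N} with hS
    have hdisc : DiscreteTopology S := by
      rw [discreteTopology_subtype_iff]
      intro t ht
      have htΩ : y + t • v ∈ Ω := ht.1.1
      have hd : HasDerivAt (fun τ : ℝ => f (y + τ • v)) (fderiv ℝ f (y + t • v) v) t := by
        have h1 : HasDerivAt (fun τ : ℝ => y + τ • v) v t := by
          simpa using ((hasDerivAt_id t).smul_const v).const_add y
        exact ((hf.differentiableAt (hΩ.mem_nhds htΩ)).hasFDerivAt).comp_hasDerivAt t h1
      have h2 := hd.eventually_ne (c := 0) ht.2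
      rw [← disjoint_iff, disjoint_principal_right]
      filter_upwards [h2] with τ hτ hτS
      apply hτ
      have h3 : Ω.indicator f (y + τ • v) = 0 := hτS.1.2
      rwa [Set.indicator_of_mem hτS.1.1] at h3
    have hcount : S.Countable := Set.countable_coe_iff.1 countable_of_Lindelof_of_discrete
    have h0 : ∀ᵐ t : ℝ, t ∉ S := measure_eq_zero_iff_ae_notMem.1 (hcount.measure_zero volume)
    filter_upwards [h0] with t ht
    simpa [hS] using ht
  filter_upwards [key] with p hp hpΩ hfp
  by_contra hne
  exact hp ⟨⟨hpΩ, by simp [hfp]⟩, hne⟩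

lemma closure_subgraph {η : E → ℝ} (hη : Continuous η) :
    closure (subgraph η) = {p | p.2 ≤ η p.1} := by
  refine Set.Subset.antisymm (closure_minimal (fun p (hp : p.2 < η p.1) => hp.le)
    (isClosed_le continuous_snd (hη.comp continuous_fst))) ?_
  intro p hp
  have h1 : Tendsto (fun s : ℝ => ((p.1, p.2 - s) : E × ℝ)) (𝓝[>] 0) (𝓝 (p.1, p.2 - 0)) :=
    ((show Continuous fun s : ℝ => ((p.1, p.2 - s) : E × ℝ) by fun_prop).tendsto 0).mono_left
      nhdsWithin_le_nhds
  rw [sub_zero] at h1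
  refine mem_closure_of_tendsto h1 ?_
  filter_upwards [self_mem_nhdsWithin] with s hs
  have h2 : 0 < s := hs
  have h3 : p.2 ≤ η p.1 := hp
  show p.2 - s < η p.1
  linarith

/-! ### Global identities by removing cutoffs and truncations -/

namespace HarmonicBelow

variable {e : A → E × ℝ} {ξ : A → (E × ℝ) →L[ℝ] ℝ} {η : E → ℝ} {φ : E × ℝ → ℝ} {G : A → E → ℝ}

lemma ae_deriv_eq_zero (D : HarmonicBelow e ξ η φ G) :
    ∀ᵐ p ∂(volume.restrict (subgraph η)), φ p = 0 → ∑ a, fderiv ℝ φ p (e a) ^ 2 = 0 := by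
  have h : ∀ᵐ p : E × ℝ, ∀ a, p ∈ subgraph η → φ p = 0 → fderiv ℝ φ p (e a) = 0 := by
    rw [ae_all_iff]
    intro a
    have : (volume : Measure (E × ℝ)).IsAddHaarMeasure := by
      rw [Measure.volume_eq_prod]
      infer_instance
    exact ae_fderiv_apply_eq_zero_of_eq_zero volume D.isOpen
      (D.contDiffOn.differentiableOn (by simp)) (e a)
  refine (ae_restrict_iff' D.isOpen.measurableSet).2 ?_
  filter_upwards [h] with p hp hpΩ hφ
  exact Finset.sum_eq_zero fun a _ => by simp [hp a hpΩ hφ]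

/-- The energy identity. -/
theorem integral_energy (D : HarmonicBelow e ξ η φ G)
    (hφ0 : Tendsto φ (cocompact (E × ℝ) ⊓ 𝓟 (closure (subgraph η))) (𝓝 0))
    (hψ : MemLp (fun x => φ (x, η x)) 2)
    (hν : MemLp (fun x => ∑ a, G a x * ((e a).2 - fderiv ℝ η x (e a).1)) 2) :
    ∫ p in subgraph η, ∑ a, fderiv ℝ φ p (e a) ^ 2 =
      ∫ x, φ (x, η x) * ∑ a, G a x * ((e a).2 - fderiv ℝ η x (e a).1) := by
  obtain ⟨T, C, hT, hTd, hTb, hT0, hT1, hTd1⟩ := exists_truncation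
  -- Decay makes `|φ|` smaller than the threshold of `T k` outside a compact set.
  have hK : ∀ k, ∃ K : Set (E × ℝ), IsCompact K ∧ ∀ p ∈ subgraph η, p ∉ K → T k (φ p) = 0 := by
    intro k
    obtain ⟨ε, hε, hTε⟩ := hT0 k
    have h1 : ∀ᶠ p in cocompact (E × ℝ) ⊓ 𝓟 (closure (subgraph η)), |φ p| < ε := by
      have := hφ0.eventually (Metric.ball_mem_nhds 0 hε)
      filter_upwards [this] with p hp
      simpa using hp
    rw [eventually_inf_principal] at h1
    obtain ⟨K, hK, hKs⟩ := mem_cocompact.1 h1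
    exact ⟨K, hK, fun p hp hpK => hTε _ (hKs hpK (subset_closure hp))⟩
  have hgreen : ∀ k, ∫ p in subgraph η, deriv (T k) (φ p) * ∑ a, fderiv ℝ φ p (e a) ^ 2 =
      ∫ x, T k (φ (x, η x)) * ∑ a, G a x * ((e a).2 - fderiv ℝ η x (e a).1) := by
    intro k
    obtain ⟨K, hK, hTK⟩ := hK k
    rw [D.integral_green (hT k) (hTd k) hK hTK]
    congr 1 with x
    rw [Finset.mul_sum]
    exact Finset.sum_congr rfl fun a _ => by ring
  have hint : IntegrableOn (fun p => ∑ a, fderiv ℝ φ p (e a) ^ 2) (subgraph η) :=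
    integrable_finsetSum _ fun a _ => (D.memLp a).integrable_sq
  have hηc := D.contDiff.continuous
  have l1 : Tendsto (fun k => ∫ p in subgraph η, deriv (T k) (φ p) * ∑ a, fderiv ℝ φ p (e a) ^ 2)
      atTop (𝓝 (∫ p in subgraph η, ∑ a, fderiv ℝ φ p (e a) ^ 2)) := by
    refine tendsto_integral_of_dominated_convergence
      (fun p => C * ‖∑ a, fderiv ℝ φ p (e a) ^ 2‖) (fun k => ?_) (hint.norm.const_mul C)
      (fun k => ae_of_all _ fun p => ?_) ?_
    · refine AEStronglyMeasurable.mul ?_ hint.1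
      refine ContinuousOn.aestronglyMeasurable ?_ D.isOpen.measurableSet
      exact ((hT k).continuous_deriv (by simp)).comp_continuousOn D.contDiffOn.continuousOn
    · rw [norm_mul]
      exact mul_le_mul_of_nonneg_right (hTd k _) (norm_nonneg _)
    · filter_upwards [D.ae_deriv_eq_zero] with p hp
      -- Each `T k` vanishes near `0`, so its derivative at `0` does not tend to `1`; on the zero
      -- set of `φ` the limit is saved by `∇φ = 0` almost everywhere.
      by_cases h : φ p = 0
      · simp [hp h]
      · refine tendsto_const_nhds.congr' ?_
        filter_upwards [hTd1 _ h] with k hk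
        rw [hk, one_mul]
  have l2 : Tendsto (fun k => ∫ x, T k (φ (x, η x)) *
        ∑ a, G a x * ((e a).2 - fderiv ℝ η x (e a).1))
      atTop (𝓝 (∫ x, φ (x, η x) * ∑ a, G a x * ((e a).2 - fderiv ℝ η x (e a).1))) := by
    refine tendsto_integral_of_dominated_convergence
      (fun x => C * ‖φ (x, η x) * ∑ a, G a x * ((e a).2 - fderiv ℝ η x (e a).1)‖) (fun k => ?_)
      ((hψ.integrable_mul hν).norm.const_mul C) (fun k => ae_of_all _ fun x => ?_)
      (ae_of_all _ fun x => ?_)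
    · exact ((hT k).continuous.comp_aestronglyMeasurable hψ.1).mul hν.1
    · rw [norm_mul, norm_mul, ← mul_assoc]
      exact mul_le_mul_of_nonneg_right (hTb k _) (norm_nonneg _)
    · refine tendsto_const_nhds.congr' ?_
      filter_upwards [hT1 (φ (x, η x))] with k hk
      rw [hk]
  refine tendsto_nhds_unique l1 (l2.congr fun k => (hgreen k).symm)

lemma sum_coord_mul_apply (hspan : ∀ p : E × ℝ, ∑ a, ξ a p • e a = p) (L : (E × ℝ) →L[ℝ] ℝ)
    (p : E × ℝ) : ∑ a, ξ a p * L (e a) = L p := by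
  conv_rhs => rw [← hspan p]
  simp [map_sum]

/-- The Rellich identity. -/
theorem integral_rellich_of_integrable (D : HarmonicBelow e ξ η φ G)
    (hspan : ∀ p : E × ℝ, ∑ a, ξ a p • e a = p)
    (hX : MemLp (fun p => ∑ b, ξ b p * fderiv ℝ φ p (e b)) 2 (volume.restrict (subgraph η)))
    (hB : Integrable fun x => ∑ a, ((∑ b, ξ b (x, η x) * G b x) * G a x -
      1 / 2 * ((∑ b, G b x ^ 2) * ξ a (x, η x))) * ((e a).2 - fderiv ℝ η x (e a).1)) :
    (1 - (Fintype.card A : ℝ) / 2) * ∫ p in subgraph η, ∑ a, fderiv ℝ φ p (e a) ^ 2 =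
    ∫ x, ∑ a, ((∑ b, ξ b (x, η x) * G b x) * G a x -
      1 / 2 * ((∑ b, G b x ^ 2) * ξ a (x, η x))) * ((e a).2 - fderiv ℝ η x (e a).1) := by
  obtain ⟨χ, C, hC0, hχ⟩ := exists_isCutoffFamily (E × ℝ)
  have hR : ∀ k : ℕ, (0 : ℝ) < (k : ℝ) + 1 := fun k => by positivity
  have hηc := D.contDiff.continuous
  set Q : E × ℝ → ℝ := fun p => ∑ a, fderiv ℝ φ p (e a) ^ 2 with hQ
  set S : E × ℝ → ℝ := fun p => ∑ b, ξ b p * fderiv ℝ φ p (e b) with hS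
  have hQi : IntegrableOn Q (subgraph η) :=
    integrable_finsetSum _ fun a _ => (D.memLp a).integrable_sq
  have hid : ∀ k : ℕ, ∫ p in subgraph η, ((1 - (Fintype.card A : ℝ) / 2) * (χ (k + 1) p * Q p) +
      (∑ a, fderiv ℝ (χ (k + 1)) p (e a) * fderiv ℝ φ p (e a)) * S p -
      1 / 2 * (Q p * fderiv ℝ (χ (k + 1)) p p)) =
      ∫ x, χ (k + 1) (x, η x) * ∑ a, ((∑ b, ξ b (x, η x) * G b x) * G a x -
        1 / 2 * ((∑ b, G b x ^ 2) * ξ a (x, η x))) * ((e a).2 - fderiv ℝ η x (e a).1) := by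
    intro k
    have := D.integral_rellich (hχ.contDiff (k + 1)) (hχ.hasCompactSupport _ (hR k))
    simp only [sum_coord_mul_apply hspan] at this
    simp only [hQ, hS, sum_coord_mul_apply hspan, this]
    congr 1 with x
    rw [Finset.mul_sum]
    exact Finset.sum_congr rfl fun a _ => by ring
  have l1 : Tendsto (fun k : ℕ => ∫ p in subgraph η,
      ((1 - (Fintype.card A : ℝ) / 2) * (χ (k + 1) p * Q p) +
      (∑ a, fderiv ℝ (χ (k + 1)) p (e a) * fderiv ℝ φ p (e a)) * S p -
      1 / 2 * (Q p * fderiv ℝ (χ (k + 1)) p p))) atTop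
      (𝓝 (∫ p in subgraph η, (1 - (Fintype.card A : ℝ) / 2) * Q p)) := by
    -- The term `X·∇χ` is bounded independently of the scale and is paired with `|∇φ|²`. The term
    -- `∇χ·∇φ` is paired with `X·∇φ`, which is in `L²` by hypothesis. Both error terms vanish
    -- eventually at each point.
    refine tendsto_integral_of_dominated_convergence
      (fun p => |1 - (Fintype.card A : ℝ) / 2| * ‖Q p‖ +
        (∑ a, (C * ‖e a‖) * ‖fderiv ℝ φ p (e a) * S p‖) + 1 / 2 * (‖Q p‖ * C)) (fun k => ?_) ?_
      (fun k => ae_of_all _ fun p => ?_) (ae_of_all _ fun p => ?_)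
    · have hc1 : Continuous (χ (k + 1)) := (hχ.contDiff _).continuous
      have hc2 : Continuous (fderiv ℝ (χ (k + 1))) :=
        (hχ.contDiff _).continuous_fderiv (by simp)
      refine ((AEStronglyMeasurable.const_mul (hc1.aestronglyMeasurable.mul hQi.1) _).add
        (AEStronglyMeasurable.mul ?_ hX.1)).sub
        (AEStronglyMeasurable.const_mul (hQi.1.mul ?_) _)
      · refine Finset.aestronglyMeasurable_fun_sum _ fun a _ => ?_
        exact AEStronglyMeasurable.mul (by fun_prop) (D.memLp a).1
      · fun_prop
    · refine ((hQi.norm.const_mul _).add ?_).add ((hQi.norm.mul_const _).const_mul _)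
      exact integrable_finsetSum _ fun a _ => ((D.memLp a).integrable_mul hX).norm.const_mul _
    · refine (norm_sub_le _ _).trans (add_le_add ((norm_add_le _ _).trans (add_le_add ?_ ?_)) ?_)
      · rw [norm_mul, norm_mul, Real.norm_eq_abs]
        have := hχ.abs_le_one (k + 1) p
        gcongr
        exact mul_le_of_le_one_left (norm_nonneg _) this
      · rw [Finset.sum_mul]
        refine (norm_sum_le _ _).trans (Finset.sum_le_sum fun a _ => ?_)
        rw [mul_assoc, norm_mul]
        gcongr
        refine ((fderiv ℝ (χ (k + 1)) p).le_opNorm _).trans ?_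
        gcongr
        refine (hχ.norm_fderiv_le _ p (hR k)).trans (div_le_self hC0 ?_)
        linarith [(Nat.cast_nonneg k : (0 : ℝ) ≤ k)]
      · rw [norm_mul, norm_mul, Real.norm_of_nonneg (by norm_num : (0 : ℝ) ≤ 1 / 2)]
        gcongr
        exact ((fderiv ℝ (χ (k + 1)) p).le_opNorm _).trans (hχ.norm_fderiv_mul_le _ p (hR k))
    · refine tendsto_const_nhds.congr' ?_
      filter_upwards [hχ.eventually p] with k hk
      simp [hk.1, hk.2]
  have l2 : Tendsto (fun k : ℕ => ∫ x, χ (k + 1) (x, η x) *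
      ∑ a, ((∑ b, ξ b (x, η x) * G b x) * G a x -
        1 / 2 * ((∑ b, G b x ^ 2) * ξ a (x, η x))) * ((e a).2 - fderiv ℝ η x (e a).1)) atTop
      (𝓝 (∫ x, ∑ a, ((∑ b, ξ b (x, η x) * G b x) * G a x -
        1 / 2 * ((∑ b, G b x ^ 2) * ξ a (x, η x))) * ((e a).2 - fderiv ℝ η x (e a).1))) := by
    refine tendsto_integral_of_dominated_convergence _ (fun k => ?_) hB.norm
      (fun k => ae_of_all _ fun x => ?_) (ae_of_all _ fun x => ?_)
    · have hc1 : Continuous (χ (k + 1)) := (hχ.contDiff _).continuous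
      exact (show Continuous fun x => χ (k + 1) (x, η x) by
        fun_prop).aestronglyMeasurable.mul hB.1
    · rw [norm_mul]
      exact mul_le_of_le_one_left (norm_nonneg _) (hχ.abs_le_one _ _)
    · refine tendsto_const_nhds.congr' ?_
      filter_upwards [hχ.eventually (x, η x)] with k hk
      rw [hk.1, one_mul]
  rw [← integral_const_mul]
  exact tendsto_nhds_unique l1 (l2.congr fun k => (hid k).symm)

/-- Only surface integrals occur, so integrability on the surface alone controls the limit; the
cutoff errors carry a factor `φ` and are dominated by products of `L²` functions. -/
theorem integral_curl_of_integrable (D : HarmonicBelow e ξ η φ G)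
    (hspan : ∀ p : E × ℝ, ∑ a, ξ a p • e a = p) (c : A → ℝ)
    (hψ : MemLp (fun x => φ (x, η x)) 2)
    (hcN : MemLp (fun x => ∑ a, c a * ((e a).2 - fderiv ℝ η x (e a).1)) 2)
    (hξN : MemLp (fun x => ∑ a, ξ a (x, η x) * ((e a).2 - fderiv ℝ η x (e a).1)) 2)
    (hB : Integrable fun x => (∑ b, ξ b (x, η x) * G b x) *
        (∑ a, c a * ((e a).2 - fderiv ℝ η x (e a).1)) -
      (∑ b, c b * G b x) * ∑ a, ξ a (x, η x) * ((e a).2 - fderiv ℝ η x (e a).1)) :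
    (∫ x, ((∑ b, ξ b (x, η x) * G b x) * (∑ a, c a * ((e a).2 - fderiv ℝ η x (e a).1)) -
      (∑ b, c b * G b x) * ∑ a, ξ a (x, η x) * ((e a).2 - fderiv ℝ η x (e a).1))) +
    ((Fintype.card A : ℝ) - 1) *
      ∫ x, φ (x, η x) * ∑ a, c a * ((e a).2 - fderiv ℝ η x (e a).1) = 0 := by
  obtain ⟨χ, C, hC0, hχ⟩ := exists_isCutoffFamily (E × ℝ)
  have hR : ∀ k : ℕ, (0 : ℝ) < (k : ℝ) + 1 := fun k => by positivity
  have hηc := D.contDiff.continuous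
  set n1 : ℝ := (Fintype.card A : ℝ) - 1
  set ψ : E → ℝ := fun x => φ (x, η x) with hψd
  set cN : E → ℝ := fun x => ∑ a, c a * ((e a).2 - fderiv ℝ η x (e a).1) with hcNd
  set ξN : E → ℝ := fun x => ∑ a, ξ a (x, η x) * ((e a).2 - fderiv ℝ η x (e a).1) with hξNd
  set B : E → ℝ := fun x => (∑ b, ξ b (x, η x) * G b x) * cN x - (∑ b, c b * G b x) * ξN x
    with hBd
  have hid : ∀ k : ℕ, ∫ x, (χ (k + 1) (x, η x) * (B x + n1 * (ψ x * cN x)) +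
      (fderiv ℝ (χ (k + 1)) (x, η x) (x, η x) * (ψ x * cN x) -
        (∑ b, c b * fderiv ℝ (χ (k + 1)) (x, η x) (e b)) * (ψ x * ξN x))) = 0 := by
    intro k
    rw [← D.integral_curl (hχ.contDiff (k + 1)) (hχ.hasCompactSupport _ (hR k)) c]
    congr 1 with x
    have e1 : ∑ b, ξ b (x, η x) * (χ (k + 1) (x, η x) * G b x +
        φ (x, η x) * fderiv ℝ (χ (k + 1)) (x, η x) (e b)) =
        χ (k + 1) (x, η x) * (∑ b, ξ b (x, η x) * G b x) +
          ψ x * fderiv ℝ (χ (k + 1)) (x, η x) (x, η x) := by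
      rw [← sum_coord_mul_apply hspan (fderiv ℝ (χ (k + 1)) (x, η x)) (x, η x), Finset.mul_sum,
        Finset.mul_sum, ← Finset.sum_add_distrib]
      exact Finset.sum_congr rfl fun b _ => by ring
    have e2 : ∑ b, c b * (χ (k + 1) (x, η x) * G b x +
        φ (x, η x) * fderiv ℝ (χ (k + 1)) (x, η x) (e b)) =
        χ (k + 1) (x, η x) * (∑ b, c b * G b x) +
          ψ x * ∑ b, c b * fderiv ℝ (χ (k + 1)) (x, η x) (e b) := by
      rw [Finset.mul_sum, Finset.mul_sum, ← Finset.sum_add_distrib]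
      exact Finset.sum_congr rfl fun b _ => by ring
    simp only [e1, e2]
    have e3 : ∀ (P Q r : ℝ), ∑ a, (P * c a - Q * ξ a (x, η x) + n1 * (r * c a)) *
        ((e a).2 - fderiv ℝ η x (e a).1) = P * cN x - Q * ξN x + n1 * (r * cN x) := by
      intro P Q r
      simp only [hcNd, hξNd, Finset.mul_sum]
      rw [← Finset.sum_sub_distrib, ← Finset.sum_add_distrib]
      exact Finset.sum_congr rfl fun b _ => by ring
    rw [e3]
    simp only [hBd, hψd]
    ring
  have hψc : Integrable fun x => ψ x * cN x := hψ.integrable_mul hcN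
  have hψξ : Integrable fun x => ψ x * ξN x := hψ.integrable_mul hξN
  have hM : Integrable fun x => B x + n1 * (ψ x * cN x) := hB.add (hψc.const_mul _)
  have l1 : Tendsto (fun k : ℕ => ∫ x, (χ (k + 1) (x, η x) * (B x + n1 * (ψ x * cN x)) +
      (fderiv ℝ (χ (k + 1)) (x, η x) (x, η x) * (ψ x * cN x) -
        (∑ b, c b * fderiv ℝ (χ (k + 1)) (x, η x) (e b)) * (ψ x * ξN x)))) atTop
      (𝓝 (∫ x, (B x + n1 * (ψ x * cN x)))) := by
    refine tendsto_integral_of_dominated_convergence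
      (fun x => ‖B x + n1 * (ψ x * cN x)‖ + (C * ‖ψ x * cN x‖ +
        (∑ b, |c b| * (C * ‖e b‖)) * ‖ψ x * ξN x‖)) (fun k => ?_)
      (hM.norm.add ((hψc.norm.const_mul _).add (hψξ.norm.const_mul _)))
      (fun k => ae_of_all _ fun x => ?_) (ae_of_all _ fun x => ?_)
    · have hc1 : Continuous (χ (k + 1)) := (hχ.contDiff _).continuous
      have hc2 : Continuous (fderiv ℝ (χ (k + 1))) :=
        (hχ.contDiff _).continuous_fderiv (by simp)
      refine AEStronglyMeasurable.add (AEStronglyMeasurable.mul ?_ hM.1)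
        ((AEStronglyMeasurable.mul ?_ hψc.1).sub (AEStronglyMeasurable.mul ?_ hψξ.1))
      · exact (show Continuous fun x => χ (k + 1) (x, η x) by fun_prop).aestronglyMeasurable
      · exact (show Continuous fun x => fderiv ℝ (χ (k + 1)) (x, η x) (x, η x) by
          fun_prop).aestronglyMeasurable
      · exact (show Continuous fun x => ∑ b, c b * fderiv ℝ (χ (k + 1)) (x, η x) (e b) by
          fun_prop).aestronglyMeasurable
    · refine (norm_add_le _ _).trans (add_le_add ?_ ((norm_sub_le _ _).trans (add_le_add ?_ ?_)))
      · rw [norm_mul]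
        exact mul_le_of_le_one_left (norm_nonneg _) (hχ.abs_le_one _ _)
      · rw [norm_mul]
        gcongr
        exact ((fderiv ℝ (χ (k + 1)) (x, η x)).le_opNorm _).trans
          (hχ.norm_fderiv_mul_le _ _ (hR k))
      · rw [norm_mul]
        gcongr
        refine (norm_sum_le _ _).trans (Finset.sum_le_sum fun b _ => ?_)
        rw [norm_mul, Real.norm_eq_abs]
        gcongr
        refine ((fderiv ℝ (χ (k + 1)) (x, η x)).le_opNorm _).trans ?_
        gcongr
        refine (hχ.norm_fderiv_le _ _ (hR k)).trans (div_le_self hC0 ?_)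
        linarith [(Nat.cast_nonneg k : (0 : ℝ) ≤ k)]
    · refine tendsto_const_nhds.congr' ?_
      filter_upwards [hχ.eventually (x, η x)] with k hk
      simp [hk.1, hk.2]
  simp_rw [hid] at l1
  have h0 := tendsto_nhds_unique l1 tendsto_const_nhds
  rw [integral_add hB (hψc.const_mul _), integral_const_mul] at h0
  exact h0

end HarmonicBelow

/-- Integration by parts for `∫ f (x · ∇f)`. -/
lemma integral_mul_fderiv_self {f : E → ℝ} (hf : ContDiff ℝ 1 f) (hf2 : MemLp f 2)
    (hxf : MemLp (fun x => fderiv ℝ f x x) 2) :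
    ∫ x, f x * fderiv ℝ f x x = -((Module.finrank ℝ E : ℝ) / 2) * ∫ x, f x ^ 2 := by
  obtain ⟨χ, C, hC0, hχ⟩ := exists_isCutoffFamily E
  have hR : ∀ k : ℕ, (0 : ℝ) < (k : ℝ) + 1 := fun k => by positivity
  let b := stdOrthonormalBasis ℝ E
  have hfc := hf.continuous
  have hcf : Continuous (fderiv ℝ f) := hf.continuous_fderiv one_ne_zero
  have i1 : Integrable fun x => f x * fderiv ℝ f x x := hf2.integrable_mul hxf
  have i2 : Integrable fun x => f x ^ 2 := hf2.integrable_sq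
  have hsum : ∀ (L : E →L[ℝ] ℝ) (x : E), ∑ i, inner ℝ (b i) x * L (b i) = L x := by
    intro L x
    conv_rhs => rw [← b.sum_repr' x]
    simp [map_sum]
  -- The integrand is the divergence of the compactly supported field `χ f² x`, with one
  -- contribution `χ f²` per basis direction.
  have hid : ∀ k : ℕ, ∫ x, (2 * (χ (k + 1) x * (f x * fderiv ℝ f x x)) +
      f x ^ 2 * fderiv ℝ (χ (k + 1)) x x + (Module.finrank ℝ E : ℝ) * (χ (k + 1) x * f x ^ 2)) =
      0 := by
    intro k
    set θ := χ (k + 1) with hθ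
    have hθd : ContDiff ℝ ∞ θ := hχ.contDiff _
    have hθc : HasCompactSupport θ := hχ.hasCompactSupport _ (hR k)
    have hθ1 : ContDiff ℝ 1 θ := hθd.of_le (by norm_cast)
    have hcθ : Continuous (fderiv ℝ θ) := hθd.continuous_fderiv (by simp)
    have hcθ0 := hθd.continuous
    have hg : ∀ i, ContDiff ℝ 1 fun x => θ x * (f x ^ 2 * inner ℝ (b i) x) := fun i =>
      hθ1.mul ((hf.pow 2).mul (contDiff_const.inner ℝ contDiff_id))
    have hgc : ∀ i, HasCompactSupport fun x => θ x * (f x ^ 2 * inner ℝ (b i) x) :=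
      fun i => hθc.mul_right
    have hint : ∀ i, Integrable fun x =>
        fderiv ℝ (fun x => θ x * (f x ^ 2 * inner ℝ (b i) x)) x (b i) := fun i =>
      Continuous.integrable_of_hasCompactSupport
        (((hg i).continuous_fderiv one_ne_zero).clm_apply continuous_const)
        ((hgc i).fderiv_apply ℝ _)
    have hz : ∀ i, ∫ x, fderiv ℝ (fun x => θ x * (f x ^ 2 * inner ℝ (b i) x)) x (b i) = 0 := by
      intro i
      have h4 := integral_mul_fderiv_eq_neg_fderiv_mul_of_integrable (μ := (volume : Measure E))
        (f := fun _ : E => (1 : ℝ)) (g := fun x => θ x * (f x ^ 2 * inner ℝ (b i) x)) (v := b i)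
        (by simp) (by simpa using hint i)
        (by simpa using (hg i).continuous.integrable_of_hasCompactSupport (hgc i))
        (fun x _ => differentiableAt_const _) (fun x _ => (hg i).differentiable one_ne_zero x)
      simpa using h4
    have hzs : ∫ x, ∑ i, fderiv ℝ (fun x => θ x * (f x ^ 2 * inner ℝ (b i) x)) x (b i) = 0 := by
      rw [integral_finsetSum _ fun i _ => hint i]
      exact Finset.sum_eq_zero fun i _ => hz i
    rw [← hzs]
    congr 1 with x
    have hd : ∀ i, fderiv ℝ (fun x => θ x * (f x ^ 2 * inner ℝ (b i) x)) x (b i) =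
        f x ^ 2 * (inner ℝ (b i) x * fderiv ℝ θ x (b i)) +
        2 * (θ x * (f x * (inner ℝ (b i) x * fderiv ℝ f x (b i)))) + θ x * f x ^ 2 := by
      intro i
      have d1 := (hθ1.differentiable one_ne_zero x).hasFDerivAt
      have d2 := (hf.differentiable one_ne_zero x).hasFDerivAt
      have d3 : HasFDerivAt (fun x => inner ℝ (b i) x) (innerSL ℝ (b i)) x :=
        (innerSL ℝ (b i)).hasFDerivAt
      have d4 : HasFDerivAt (fun x => θ x * (f x ^ 2 * inner ℝ (b i) x)) _ x :=
        d1.mul ((d2.pow 2).mul d3)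
      rw [d4.fderiv]
      simp
      ring
    simp_rw [hd]
    simp only [Finset.sum_add_distrib, ← Finset.mul_sum, hsum, Finset.sum_const, Finset.card_univ,
      nsmul_eq_mul, Fintype.card_fin]
    ring
  have l1 : Tendsto (fun k : ℕ => ∫ x, (2 * (χ (k + 1) x * (f x * fderiv ℝ f x x)) +
      f x ^ 2 * fderiv ℝ (χ (k + 1)) x x + (Module.finrank ℝ E : ℝ) * (χ (k + 1) x * f x ^ 2)))
      atTop (𝓝 (∫ x, (2 * (f x * fderiv ℝ f x x) + (Module.finrank ℝ E : ℝ) * f x ^ 2))) := by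
    refine tendsto_integral_of_dominated_convergence
      (fun x => 2 * ‖f x * fderiv ℝ f x x‖ + ‖f x ^ 2‖ * C +
        (Module.finrank ℝ E : ℝ) * ‖f x ^ 2‖) (fun k => ?_)
      (((i1.norm.const_mul _).add (i2.norm.mul_const _)).add (i2.norm.const_mul _))
      (fun k => ae_of_all _ fun x => ?_) (ae_of_all _ fun x => ?_)
    · have hc1 : Continuous (χ (k + 1)) := (hχ.contDiff _).continuous
      have hc2 : Continuous (fderiv ℝ (χ (k + 1))) :=
        (hχ.contDiff _).continuous_fderiv (by simp)
      exact Continuous.aestronglyMeasurable (by fun_prop)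
    · have h1 := hχ.abs_le_one (k + 1) x
      refine (norm_add_le _ _).trans (add_le_add ((norm_add_le _ _).trans (add_le_add ?_ ?_)) ?_)
      · rw [norm_mul, norm_mul _ (f x * _), Real.norm_of_nonneg zero_le_two]
        gcongr
        exact mul_le_of_le_one_left (norm_nonneg _) h1
      · rw [norm_mul]
        gcongr
        exact ((fderiv ℝ (χ (k + 1)) x).le_opNorm _).trans (hχ.norm_fderiv_mul_le _ _ (hR k))
      · rw [norm_mul, norm_mul _ (f x ^ 2), Real.norm_of_nonneg (Nat.cast_nonneg _)]
        gcongr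
        exact mul_le_of_le_one_left (norm_nonneg _) h1
    · refine tendsto_const_nhds.congr' ?_
      filter_upwards [hχ.eventually x] with k hk
      simp [hk.1, hk.2]
  simp_rw [hid] at l1
  have h0 := tendsto_nhds_unique l1 tendsto_const_nhds
  rw [integral_add (i1.const_mul _) (i2.const_mul _), integral_const_mul, integral_const_mul] at h0
  linarith

/-! ### Orthonormal frame and translation of the given hypotheses -/

/-- The orthonormal frame of `E × ℝ` given by an orthonormal basis of `E` and the vertical
direction. -/
def frame {ι : Type*} [Fintype ι] (b : OrthonormalBasis ι ℝ E) : Option ι → E × ℝ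
  | none => (0, 1)
  | some i => (b i, 0)

/-- The coordinates dual to `frame`. -/
def coord {ι : Type*} [Fintype ι] (b : OrthonormalBasis ι ℝ E) : Option ι → (E × ℝ) →L[ℝ] ℝ
  | none => ContinuousLinearMap.snd ℝ E ℝ
  | some i => (innerSL ℝ (b i)).comp (ContinuousLinearMap.fst ℝ E ℝ)

/-- The components in `frame` of a vector field on `E` with horizontal part `Gx` and vertical
part `Gy`. -/
def components {ι : Type*} [Fintype ι] (b : OrthonormalBasis ι ℝ E) (Gx : E → E) (Gy : E → ℝ) :
    Option ι → E → ℝ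
  | none => Gy
  | some i => fun x => ⟪b i, Gx x⟫_ℝ

section Frame

variable {ι : Type*} [Fintype ι] [DecidableEq ι] (b : OrthonormalBasis ι ℝ E)

lemma coord_frame (i j : Option ι) : coord b i (frame b j) = if i = j then 1 else 0 := by
  rcases i with _ | i <;> rcases j with _ | j <;>
    simp [coord, frame, b.inner_eq_ite]

lemma sum_coord_smul_frame (p : E × ℝ) : ∑ i, coord b i p • frame b i = p := by
  rw [Fintype.sum_option]
  have h : ∀ v : E, ∑ i, ⟪b i, v⟫_ℝ • b i = v := fun v => b.sum_repr' v
  ext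
  · simp [coord, frame, Prod.fst_sum, h]
  · simp [coord, frame, Prod.snd_sum]

lemma sum_inner_mul_apply (L : E →L[ℝ] ℝ) (x : E) : ∑ i, ⟪b i, x⟫_ℝ * L (b i) = L x := by
  conv_rhs => rw [← b.sum_repr' x]
  simp [map_sum]

/-- With `L = fderiv ℝ η x`, the second factors are the components of the normal `(-∇η, 1)`, so the
sum is the normal flux. -/
lemma sum_components_mul_normal (Gx : E → E) (Gy : E → ℝ) (L : E →L[ℝ] ℝ) (x : E) :
    ∑ i, components b Gx Gy i x * ((frame b i).2 - L (frame b i).1) = Gy x - L (Gx x) := by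
  rw [Fintype.sum_option]
  simp [components, frame, sum_inner_mul_apply]
  ring

lemma sum_coord_mul_normal (L : E →L[ℝ] ℝ) (p : E × ℝ) :
    ∑ i, coord b i p * ((frame b i).2 - L (frame b i).1) = p.2 - L p.1 := by
  rw [Fintype.sum_option]
  simp [coord, frame, sum_inner_mul_apply]
  ring

lemma sum_coord_mul_components (Gx : E → E) (Gy : E → ℝ) (p : E × ℝ) (x : E) :
    ∑ i, coord b i p * components b Gx Gy i x = ⟪p.1, Gx x⟫_ℝ + p.2 * Gy x := by
  rw [Fintype.sum_option]
  have h := b.sum_inner_mul_inner p.1 (Gx x)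
  simp only [coord, components, ContinuousLinearMap.comp_apply, ContinuousLinearMap.coe_fst',
    ContinuousLinearMap.coe_snd', innerSL_apply_apply]
  simp_rw [real_inner_comm p.1]
  rw [h]
  ring

lemma sum_components_sq (Gx : E → E) (Gy : E → ℝ) (x : E) :
    ∑ i, components b Gx Gy i x ^ 2 = ‖Gx x‖ ^ 2 + Gy x ^ 2 := by
  rw [Fintype.sum_option, ← b.sum_sq_norm_inner_right (Gx x)]
  simp [components, add_comm]

end Frame

lemma inner_gradient_left {f : E → ℝ} {x v : E} : ⟪gradient f x, v⟫_ℝ = fderiv ℝ f x v := by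
  rw [← toDual_gradient, InnerProductSpace.toDual_apply_apply]

section Slices

variable {φ : E × ℝ → ℝ} {Ω : Set (E × ℝ)} {p : E × ℝ}

lemma fderiv_slice_fst (h : DifferentiableAt ℝ φ p) (v : E) :
    fderiv ℝ (fun x => φ (x, p.2)) p.1 v = fderiv ℝ φ p (v, 0) := by
  have h1 : HasFDerivAt (fun x : E => (x, p.2)) (ContinuousLinearMap.inl ℝ E ℝ) p.1 :=
    hasFDerivAt_prodMk_left p.1 p.2
  have h2 : HasFDerivAt (fun x => φ (x, p.2)) _ p.1 :=
    (show HasFDerivAt φ (fderiv ℝ φ p) (p.1, p.2) from h.hasFDerivAt).comp p.1 h1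
  rw [h2.fderiv]
  simp

lemma deriv_slice_snd (h : DifferentiableAt ℝ φ p) :
    deriv (fun y => φ (p.1, y)) p.2 = fderiv ℝ φ p (0, 1) := by
  have h1 : HasFDerivAt (fun y : ℝ => (p.1, y)) (ContinuousLinearMap.inr ℝ E ℝ) p.2 :=
    hasFDerivAt_prodMk_right p.1 p.2
  have h2 : HasFDerivAt (fun y => φ (p.1, y)) _ p.2 :=
    (show HasFDerivAt φ (fderiv ℝ φ p) (p.1, p.2) from h.hasFDerivAt).comp p.2 h1
  rw [h2.hasDerivAt.deriv]
  simp

lemma fderiv_fderiv_slice_fst (hΩ : IsOpen Ω) (hφ : ContDiffOn ℝ ∞ φ Ω) (hp : p ∈ Ω) (v w : E) :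
    fderiv ℝ (fderiv ℝ (fun x => φ (x, p.2))) p.1 v w =
      fderiv ℝ (fun q => fderiv ℝ φ q (w, 0)) p (v, 0) := by
  have hs : ContDiffAt ℝ ∞ (fun x => φ (x, p.2)) p.1 :=
    ContDiffAt.comp (g := φ) p.1 (hφ.contDiffAt (hΩ.mem_nhds hp)) (by fun_prop)
  have hd : DifferentiableAt ℝ (fderiv ℝ (fun x => φ (x, p.2))) p.1 :=
    (hs.fderiv_right (m := 1) (by norm_cast)).differentiableAt one_ne_zero
  have h1 : fderiv ℝ (fderiv ℝ (fun x => φ (x, p.2))) p.1 v w =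
      fderiv ℝ (fun x => fderiv ℝ (fun x => φ (x, p.2)) x w) p.1 v := by
    rw [fderiv_clm_apply hd (differentiableAt_const w)]
    simp
  have h2 : (fun x => fderiv ℝ (fun x => φ (x, p.2)) x w) =ᶠ[𝓝 p.1]
      fun x => fderiv ℝ φ (x, p.2) (w, 0) := by
    have hc : Continuous fun x : E => (x, p.2) := by fun_prop
    filter_upwards [(hΩ.preimage hc).mem_nhds hp] with x hx
    exact fderiv_slice_fst (p := (x, p.2))
      ((hφ.contDiffAt (hΩ.mem_nhds hx)).differentiableAt (by simp)) w
  rw [h1, h2.fderiv_eq]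
  exact fderiv_slice_fst (φ := fun q => fderiv ℝ φ q (w, 0))
    (((contDiffOn_fderiv_apply hΩ hφ _).contDiffAt (hΩ.mem_nhds hp)).differentiableAt (by simp)) v

lemma iteratedDeriv_two_slice_snd (hΩ : IsOpen Ω) (hφ : ContDiffOn ℝ ∞ φ Ω) (hp : p ∈ Ω) :
    iteratedDeriv 2 (fun y => φ (p.1, y)) p.2 =
      fderiv ℝ (fun q => fderiv ℝ φ q (0, 1)) p (0, 1) := by
  rw [iteratedDeriv_succ, iteratedDeriv_one]
  have h2 : deriv (fun y => φ (p.1, y)) =ᶠ[𝓝 p.2] fun y => fderiv ℝ φ (p.1, y) (0, 1) := by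
    have hc : Continuous fun y : ℝ => (p.1, y) := by fun_prop
    filter_upwards [(hΩ.preimage hc).mem_nhds hp] with y hy
    exact deriv_slice_snd (p := (p.1, y))
      ((hφ.contDiffAt (hΩ.mem_nhds hy)).differentiableAt (by simp))
  rw [h2.deriv_eq]
  exact deriv_slice_snd (φ := fun q => fderiv ℝ φ q (0, 1))
    (((contDiffOn_fderiv_apply hΩ hφ _).contDiffAt (hΩ.mem_nhds hp)).differentiableAt (by simp))

end Slices

/-- The limit is locally in `L^p` automatically: on a ball, `g = f s - (f s - g)` for any one `s` at
which the last norm is finite. -/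
lemma TendstoLocLp.of_tendsto {p : ENNReal} {f : ℝ → E → ℝ} {g : E → ℝ}
    (hf : ∀ s, 0 < s → Continuous (f s)) (hg : AEStronglyMeasurable g)
    (h : ∀ R : ℝ, Tendsto (fun s => eLpNorm (f s - g) p (volume.restrict (Metric.ball 0 R)))
      (𝓝[>] 0) (𝓝 0)) : TendstoLocLp p f g where
  aestronglyMeasurable s hs := (hf s hs).aestronglyMeasurable
  tendsto := h
  memLp R := by
    have hlt : ∀ᶠ s in 𝓝[>] (0 : ℝ), eLpNorm (f s - g) p (volume.restrict (Metric.ball 0 R)) < 1 :=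
      (h R).eventually (gt_mem_nhds zero_lt_one)
    obtain ⟨s, hs, hs0⟩ := (hlt.and self_mem_nhdsWithin).exists
    have h1 : MemLp (f s - g) p (volume.restrict (Metric.ball 0 R)) :=
      ⟨((hf s hs0).aestronglyMeasurable.sub hg).restrict, hs.trans ENNReal.one_lt_top⟩
    have h2 := ((TendstoLocLp.of_continuous p (hf s hs0)).memLp R).sub h1
    rwa [sub_sub_cancel] at h2

/-- A weak gradient of an `H¹` function is square integrable. -/
lemma MemH1.memLp_of_hasWeakGradient {n : ℕ} {f : Horiz n → ℝ} (hf : MemH1 f)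
    {P : Horiz n → Horiz n} (hP : LocallyIntegrable P) (h : HasWeakGradient f P) : MemLp P 2 := by
  obtain ⟨-, F, hF, hw⟩ := hf
  have hFi : LocallyIntegrable F := hF.locallyIntegrable one_le_two
  -- Weak gradients are unique: the difference integrates to zero against every test function.
  have hz : ∀ᵐ x, F x - P x = 0 := by
    refine ae_eq_zero_of_integral_contDiff_smul_eq_zero (hFi.sub hP) fun χ hχ hχc => ?_
    have i1 : Integrable fun x => χ x • F x :=
      hFi.integrable_smul_left_of_hasCompactSupport hχ.continuous hχc
    have i2 : Integrable fun x => χ x • P x :=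
      hP.integrable_smul_left_of_hasCompactSupport hχ.continuous hχc
    refine ext_inner_left ℝ fun v => ?_
    have e1 := hw χ hχ hχc v
    have e2 := h χ hχ hχc v
    have e3 : ∀ {H : Horiz n → Horiz n}, Integrable (fun x => χ x • H x) →
        ⟪v, ∫ x, χ x • H x⟫_ℝ = ∫ x, ⟪H x, v⟫_ℝ * χ x := by
      intro H hH
      rw [← integral_inner hH v]
      congr 1 with x
      rw [inner_smul_right, real_inner_comm, mul_comm]
    simp_rw [smul_sub]
    rw [integral_sub i1 i2, inner_sub_right, e3 i1, e3 i2, inner_zero_right]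
    linarith
  refine hF.ae_eq ?_
  filter_upwards [hz] with x hx
  exact sub_eq_zero.1 hx

lemma hasWeakGradient_gradient {n : ℕ} {f : Horiz n → ℝ} (hf : ContDiff ℝ 1 f) :
    HasWeakGradient f (gradient f) := by
  intro χ hχ hχc v
  have hcf := hf.continuous_fderiv one_ne_zero
  have hcχ := hχ.continuous_fderiv (by simp)
  simp_rw [inner_gradient_left]
  exact integral_mul_fderiv_eq_neg_fderiv_mul_of_integrable
    (Continuous.integrable_of_hasCompactSupport
      ((hcf.clm_apply continuous_const).mul hχ.continuous) hχc.mul_left)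
    (Continuous.integrable_of_hasCompactSupport
      (hf.continuous.mul (hcχ.clm_apply continuous_const)) (hχc.fderiv_apply ℝ v).mul_left)
    (Continuous.integrable_of_hasCompactSupport (hf.continuous.mul hχ.continuous) hχc.mul_left)
    (fun x _ => hf.differentiable one_ne_zero x) (fun x _ => hχ.differentiable (by simp) x)

lemma continuous_gradient {f : E → ℝ} (hf : ContDiff ℝ 1 f) : Continuous (gradient f) :=
  (InnerProductSpace.toDual ℝ E).symm.continuous.comp (hf.continuous_fderiv one_ne_zero)

/-- The conditions on a solitary wave, in terms of an orthonormal frame. -/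
lemma IsSolitaryWave.harmonicBelow {n : ℕ} {g : ℝ} {c : Horiz n} {η : Horiz n → ℝ}
    {φ : Horiz n × ℝ → ℝ} {Gx : Horiz n → Horiz n} {Gy : Horiz n → ℝ}
    (hsol : IsSolitaryWave g c η φ Gx Gy) (hη : ContDiff ℝ 1 η)
    (hφ : ContDiffOn ℝ ∞ φ (fluidDomain η)) (hφc : ContinuousOn φ (closure (fluidDomain η)))
    (hφx : MemLp (gradX φ) 2 (volume.restrict (fluidDomain η)))
    (hφy : MemLp (derivY φ) 2 (volume.restrict (fluidDomain η)))
    {ι : Type*} [Fintype ι] [DecidableEq ι] (b : OrthonormalBasis ι ℝ (Horiz n)) :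
    HarmonicBelow (frame b) (coord b) η φ (components b Gx Gy) := by
  have hO : IsOpen (subgraph η) := isOpen_subgraph hη.continuous
  have hφs : ContDiffOn ℝ ∞ φ (subgraph η) := hφ
  have hda : ∀ p ∈ subgraph η, DifferentiableAt ℝ φ p := fun p hp =>
    (hφs.contDiffAt (hO.mem_nhds hp)).differentiableAt (by simp)
  have hx : ∀ p ∈ subgraph η, ∀ v, ⟪v, gradX φ p⟫_ℝ = fderiv ℝ φ p (v, 0) := by
    intro p hp v
    rw [real_inner_comm, gradX, inner_gradient_left, fderiv_slice_fst (hda p hp)]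
  have hy : ∀ p ∈ subgraph η, derivY φ p = fderiv ℝ φ p (0, 1) := fun p hp =>
    deriv_slice_snd (hda p hp)
  have hmem : ∀ s : ℝ, 0 < s → ∀ x : Horiz n, (x, η x - s) ∈ subgraph η := fun s hs x => by
    simpa [subgraph] using hs
  have hcont : ∀ (v : Horiz n × ℝ) (s : ℝ), 0 < s →
      Continuous fun x => fderiv ℝ φ (x, η x - s) v := fun v s hs =>
    (contDiffOn_fderiv_apply hO hφs v).continuousOn.comp_continuous
      (by have := hη.continuous; fun_prop) (hmem s hs)
  refine ⟨coord_frame b, hη, hφs, ?_, ?_, ?_, ?_⟩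
  · rw [← closure_subgraph hη.continuous]
    exact hφc
  · intro p hp
    have h := hsol.harmonic p hp
    rw [laplace, InnerProductSpace.laplacian_eq_iteratedFDeriv_orthonormalBasis _ b,
      iteratedDeriv_two_slice_snd hO hφs hp] at h
    simp only [iteratedFDeriv_two_apply] at h
    rw [Fintype.sum_option, add_comm]
    rw [← h]
    congr 1
    refine Finset.sum_congr rfl fun i _ => ?_
    exact (fderiv_fderiv_slice_fst hO hφs hp (b i) (b i)).symm
  · rintro (_ | i)
    · refine TendstoLocLp.of_tendsto (hcont _)
        hsol.boundaryGradient.aestronglyMeasurable_y fun R => ?_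
      refine (hsol.boundaryGradient.tendsto_y R).congr' ?_
      filter_upwards [self_mem_nhdsWithin] with s hs
      congr 1
      ext x
      simp [hy _ (hmem s hs x), frame, components]
    · have hm : AEStronglyMeasurable (components b Gx Gy (some i)) volume :=
        (innerSL ℝ (b i)).continuous.comp_aestronglyMeasurable
          hsol.boundaryGradient.aestronglyMeasurable_x
      refine TendstoLocLp.of_tendsto (hcont _) hm fun R => ?_
      refine tendsto_of_tendsto_of_tendsto_of_le_of_le' tendsto_const_nhds
        (hsol.boundaryGradient.tendsto_x R) (Eventually.of_forall fun _ => zero_le) ?_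
      filter_upwards [self_mem_nhdsWithin] with s hs
      refine eLpNorm_mono fun x => ?_
      have e1 : fderiv ℝ φ (x, η x - s) (frame b (some i)) - components b Gx Gy (some i) x =
          ⟪b i, gradX φ (x, η x - s) - Gx x⟫_ℝ := by
        rw [inner_sub_right, hx _ (hmem s hs x)]
        rfl
      simp only [Pi.sub_apply]
      rw [e1]
      refine (norm_inner_le_norm _ _).trans ?_
      simp [b.norm_eq_one]
  · rintro (_ | i)
    · refine hφy.ae_eq ?_
      filter_upwards [ae_restrict_mem hO.measurableSet] with p hp
      exact hy p hp
    · refine (ContinuousLinearMap.comp_memLp' (innerSL ℝ (b i)) hφx).ae_eq ?_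
      filter_upwards [ae_restrict_mem hO.measurableSet] with p hp
      exact hx p hp (b i)

/-! ### Vanishing from decay at infinity -/

lemma exists_bound_of_tendsto_zero {X : Type*} [TopologicalSpace X] {f : X → ℝ}
    (hf : Continuous f) (h : Tendsto f (cocompact X) (𝓝 0)) : ∃ C, ∀ x, ‖f x‖ ≤ C := by
  obtain ⟨K, hK, hKs⟩ := mem_cocompact.1 (h.eventually (Metric.ball_mem_nhds 0 one_pos))
  obtain ⟨C, hC⟩ := hK.exists_bound_of_continuousOn hf.continuousOn
  refine ⟨max C 1, fun x => ?_⟩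
  by_cases hx : x ∈ K
  · exact (hC x hx).trans (le_max_left _ _)
  · have : f x ∈ Metric.ball (0 : ℝ) 1 := hKs hx
    exact (mem_ball_zero_iff.1 this).le.trans (le_max_right _ _)

lemma tendsto_add_smul_cocompact {V : Type*} [NormedAddCommGroup V] [NormedSpace ℝ V] (x : V)
    {v : V} (hv : v ≠ 0) : Tendsto (fun t : ℝ => x + t • v) atTop (cocompact V) := by
  refine tendsto_cocompact_of_tendsto_dist_comp_atTop (x := x) ?_
  have : (fun t : ℝ => dist (x + t • v) x) = fun t => |t| * ‖v‖ := by
    ext t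
    simp [dist_eq_norm, norm_smul]
  rw [this]
  exact tendsto_abs_atTop_atTop.atTop_mul_const (norm_pos_iff.2 hv)

/-- A `C¹` function that vanishes at infinity and is constant in some direction is zero. -/
lemma eq_zero_of_fderiv_apply_eq_zero {V : Type*} [NormedAddCommGroup V] [NormedSpace ℝ V]
    {f : V → ℝ} (hf : Differentiable ℝ f) (h : Tendsto f (cocompact V) (𝓝 0)) {v : V} (hv : v ≠ 0)
    (hfv : ∀ x, fderiv ℝ f x v = 0) (x : V) : f x = 0 := by
  have hd : ∀ t : ℝ, HasDerivAt (fun t : ℝ => f (x + t • v)) 0 t := by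
    intro t
    have h1 : HasDerivAt (fun τ : ℝ => x + τ • v) v t := by
      simpa using ((hasDerivAt_id t).smul_const v).const_add x
    have h2 := (hf (x + t • v)).hasFDerivAt.comp_hasDerivAt t h1
    rwa [hfv] at h2
  have hc : ∀ t : ℝ, f (x + t • v) = f x := by
    intro t
    have := is_const_of_deriv_eq_zero (fun t => (hd t).differentiableAt) (fun t => (hd t).deriv) t 0
    simpa using this
  have h3 := h.comp (tendsto_add_smul_cocompact x hv)
  have h4 : (f ∘ fun t : ℝ => x + t • v) = fun _ => f x := by
    ext t
    exact hc t
  rw [h4] at h3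
  exact tendsto_nhds_unique tendsto_const_nhds h3

/-- A function that decays below the graph of `η` and has no vertical derivative there is zero. -/
lemma eq_zero_of_fderiv_vertical_eq_zero {η : E → ℝ} (hη : Continuous η) {φ : E × ℝ → ℝ}
    (hφ : DifferentiableOn ℝ φ (subgraph η)) (hφc : ContinuousOn φ (closure (subgraph η)))
    (hφ0 : Tendsto φ (cocompact (E × ℝ) ⊓ 𝓟 (closure (subgraph η))) (𝓝 0))
    (hv : ∀ p ∈ subgraph η, fderiv ℝ φ p (0, 1) = 0) :
    ∀ p ∈ closure (subgraph η), φ p = 0 := by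
  have hO := isOpen_subgraph hη
  have hin : ∀ p ∈ subgraph η, φ p = 0 := by
    intro p hp
    have hd : ∀ y ∈ Set.Iio (η p.1), HasDerivAt (fun y => φ (p.1, y)) 0 y := by
      intro y hy
      have hy' : (p.1, y) ∈ subgraph η := hy
      have h1 : HasFDerivAt (fun y : ℝ => (p.1, y)) (ContinuousLinearMap.inr ℝ E ℝ) y :=
        hasFDerivAt_prodMk_right p.1 y
      have h2 := ((hφ.differentiableAt (hO.mem_nhds hy')).hasFDerivAt.comp y h1).hasDerivAt
      simpa [hv _ hy'] using! h2
    have hc : ∀ t : ℝ, 0 ≤ t → φ (p + t • (0, -1)) = φ p := by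
      intro t ht
      have hp' : p.2 < η p.1 := hp
      have := isOpen_Iio.is_const_of_deriv_eq_zero (isPreconnected_Iio (a := η p.1))
        (fun y hy => (hd y hy).differentiableAt.differentiableWithinAt) (fun y hy => (hd y hy).deriv)
        (show p.2 + t * (-1) ∈ Set.Iio (η p.1) by simp only [Set.mem_Iio]; linarith) hp
      convert! this using 2
      ext <;> simp
    have hne : ((0, -1) : E × ℝ) ≠ 0 := by simp [Prod.ext_iff]
    have h3 : Tendsto (fun t : ℝ => φ (p + t • ((0, -1) : E × ℝ))) atTop (𝓝 0) := by
      refine hφ0.comp (tendsto_inf.2 ⟨tendsto_add_smul_cocompact p hne, tendsto_principal.2 ?_⟩)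
      filter_upwards [eventually_ge_atTop 0] with t ht
      refine subset_closure ?_
      have hp' : p.2 < η p.1 := hp
      show (p + t • ((0, -1) : E × ℝ)).2 < η (p + t • ((0, -1) : E × ℝ)).1
      simp
      linarith
    refine tendsto_nhds_unique (tendsto_const_nhds.congr' ?_) h3
    filter_upwards [eventually_ge_atTop 0] with t ht
    exact (hc t ht).symm
  intro p hp
  exact Set.EqOn.of_subset_closure (f := φ) (g := fun _ => 0) hin hφc continuousOn_const
    subset_closure Set.Subset.rfl hp

/-! ### Square integrability on the surface and the virial identity -/

/-- `|G|² ≤ |Gₓ + G_y k|² + (G_y - Gₓ·k)²`: a vector is controlled by its tangential and normal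
components on a graph of slope `k`. -/
lemma norm_sq_add_sq_le (v k : E) (r : ℝ) :
    ‖v‖ ^ 2 + r ^ 2 ≤ ‖v + r • k‖ ^ 2 + (r - ⟪v, k⟫_ℝ) ^ 2 := by
  rw [norm_add_sq_real, inner_smul_right, norm_smul, mul_pow, Real.norm_eq_abs, sq_abs]
  nlinarith [sq_nonneg (⟪v, k⟫_ℝ), mul_nonneg (sq_nonneg r) (sq_nonneg ‖k‖)]

lemma memLp_of_memLp_inner {X : Type*} [MeasurableSpace X] {μ : Measure X} {ι : Type*} [Fintype ι]
    (b : OrthonormalBasis ι ℝ E) {f : X → E} {p : ENNReal}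
    (h : ∀ i, MemLp (fun x => ⟪b i, f x⟫_ℝ) p μ) : MemLp f p μ := by
  have e : f = fun x => ∑ i, ⟪b i, f x⟫_ℝ • b i := by
    ext1 x
    exact (b.sum_repr' (f x)).symm
  rw [e]
  exact memLp_finsetSum _ fun i _ =>
    ContinuousLinearMap.comp_memLp' (ContinuousLinearMap.toSpanSingleton ℝ (b i)) (h i)

lemma locallyIntegrable_of_memLp_ball {F : Type*} [NormedAddCommGroup F] {f : E → F} {p : ENNReal}
    (hp : 1 ≤ p) (h : ∀ R : ℝ, MemLp f p (volume.restrict (Metric.ball 0 R))) :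
    LocallyIntegrable f := by
  intro x
  refine ⟨Metric.ball 0 (‖x‖ + 1), Metric.isOpen_ball.mem_nhds (by simp), ?_⟩
  have : IsFiniteMeasure (volume.restrict (Metric.ball (0 : E) (‖x‖ + 1))) :=
    ⟨by simpa using measure_ball_lt_top⟩
  exact (h _).integrable hp

section SolitaryWave

variable {n : ℕ} {g : ℝ} {c : Horiz n} {η : Horiz n → ℝ} {φ : Horiz n × ℝ → ℝ}
  {Gx : Horiz n → Horiz n} {Gy : Horiz n → ℝ}

/-- The boundary value of the gradient is square integrable. -/
lemma IsSolitaryWave.memLp_boundaryGradient {ι : Type*} [Fintype ι] [DecidableEq ι]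
    {b : OrthonormalBasis ι ℝ (Horiz n)} (hsol : IsSolitaryWave g c η φ Gx Gy)
    (D : HarmonicBelow (frame b) (coord b) η φ (components b Gx Gy))
    (hη : MemLp (gradient η) 2) (hφH1 : MemH1 fun x => φ (x, η x)) : MemLp Gx 2 ∧ MemLp Gy 2 := by
  have hGx : AEStronglyMeasurable Gx := hsol.boundaryGradient.aestronglyMeasurable_x
  have hGy : AEStronglyMeasurable Gy := hsol.boundaryGradient.aestronglyMeasurable_y
  have hgc := continuous_gradient D.contDiff
  -- The chain rule candidate for the gradient of `x ↦ φ (x, η x)`; it carries the tangential part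
  -- of the boundary gradient.
  set P : Horiz n → Horiz n := fun x => Gx x + Gy x • gradient η x with hP
  have hloc : LocallyIntegrable P := by
    refine locallyIntegrable_of_memLp_ball one_le_two fun R => MemLp.add ?_ ?_
    · exact memLp_of_memLp_inner b fun i => (D.boundary (some i)).memLp R
    · refine MemLp.smul (p := 2) (q := ⊤) ?_ ((D.boundary none).memLp R)
      obtain ⟨C, hC⟩ := (isCompact_closedBall (0 : Horiz n) R).exists_bound_of_continuousOn
        hgc.continuousOn
      refine memLp_top_of_bound hgc.aestronglyMeasurable C ?_
      filter_upwards [ae_restrict_mem Metric.isOpen_ball.measurableSet] with x hx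
      exact hC x (Metric.ball_subset_closedBall hx)
  have hw : HasWeakGradient (fun x => φ (x, η x)) P := by
    intro χ hχ hχc v
    rw [D.integral_trace_mul_fderiv (sum_coord_smul_frame b) (hχ.of_le (by norm_cast)) hχc v]
    congr 2 with x
    rw [sum_coord_mul_components b Gx Gy (v, fderiv ℝ η x v) x, hP, inner_add_left,
      inner_smul_left, inner_gradient_left, real_inner_comm]
    simp [mul_comm]
  have hPL : MemLp P 2 := hφH1.memLp_of_hasWeakGradient hloc hw
  have hcη : MemLp (fun x => ⟪c, gradient η x⟫_ℝ) 2 :=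
    ContinuousLinearMap.comp_memLp' (innerSL ℝ c) hη
  -- The kinematic condition identifies the normal component as `-c·∇η`; then `p² + q² ≤ (p + q)²`
  -- for nonnegative `p`, `q`.
  have hbound : ∀ᵐ x, ‖Gx x‖ ^ 2 + Gy x ^ 2 ≤ (‖P x‖ + ‖⟪c, gradient η x⟫_ℝ‖) ^ 2 := by
    filter_upwards [hsol.kinematic] with x hx
    have h1 := norm_sq_add_sq_le (Gx x) (gradient η x) (Gy x)
    have h2 : Gy x - ⟪Gx x, gradient η x⟫_ℝ = -⟪c, gradient η x⟫_ℝ := by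
      rw [hx, inner_sub_left]
      ring
    rw [h2] at h1
    have h3 : (-⟪c, gradient η x⟫_ℝ) ^ 2 = ‖⟪c, gradient η x⟫_ℝ‖ ^ 2 := by
      rw [Real.norm_eq_abs, sq_abs, neg_sq]
    rw [h3] at h1
    nlinarith [norm_nonneg (P x), norm_nonneg (⟪c, gradient η x⟫_ℝ),
      mul_nonneg (norm_nonneg (P x)) (norm_nonneg (⟪c, gradient η x⟫_ℝ))]
  have hdom := hPL.norm.add hcη.norm
  have hdom0 : ∀ x, 0 ≤ ‖P x‖ + ‖⟪c, gradient η x⟫_ℝ‖ := fun x =>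
    add_nonneg (norm_nonneg _) (norm_nonneg _)
  constructor
  · refine hdom.mono hGx ?_
    filter_upwards [hbound] with x hx
    refine le_trans ?_ (le_abs_self _)
    refine abs_le_of_sq_le_sq' (a := ‖Gx x‖) ?_ (hdom0 x) |>.2
    exact (le_add_of_nonneg_right (sq_nonneg _)).trans hx
  · refine hdom.mono hGy ?_
    filter_upwards [hbound] with x hx
    refine le_trans ?_ (le_abs_self _)
    refine abs_le_of_sq_le_sq' (a := ‖Gy x‖) ?_ (hdom0 x) |>.2
    rw [Real.norm_eq_abs, sq_abs]
    exact (le_add_of_nonneg_left (sq_nonneg _)).trans hx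

/-- The virial identity: `n` times the kinetic energy is `n + 1` times the potential energy. -/
theorem IsSolitaryWave.virial {ι : Type*} [Fintype ι] [DecidableEq ι]
    {b : OrthonormalBasis ι ℝ (Horiz n)} (hsol : IsSolitaryWave g c η φ Gx Gy)
    (D : HarmonicBelow (frame b) (coord b) η φ (components b Gx Gy))
    (hηH1 : MemH1 η) (hxη : MemLp (fun x : Horiz n => ⟪x, gradient η x⟫_ℝ) 2)
    (hX : MemLp (fun p => ∑ i, coord b i p * fderiv ℝ φ p (frame b i)) 2
      (volume.restrict (subgraph η)))
    (hφH1 : MemH1 fun x => φ (x, η x)) (hxG : MemLp (fun x : Horiz n => ⟪x, Gx x⟫_ℝ) 2) :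
    ((Fintype.card ι : ℝ) + 1) * ∫ p in subgraph η, ∑ i, fderiv ℝ φ p (frame b i) ^ 2 =
      ((Fintype.card ι : ℝ) + 2) * (g * ∫ x, η x ^ 2) := by
  have hηc := D.contDiff.continuous
  have hgη : MemLp (gradient η) 2 := hηH1.memLp_of_hasWeakGradient
    (continuous_gradient D.contDiff).locallyIntegrable (hasWeakGradient_gradient D.contDiff)
  obtain ⟨hGx, hGy⟩ := hsol.memLp_boundaryGradient D hgη hφH1
  obtain ⟨M, hM⟩ := exists_bound_of_tendsto_zero hηc hsol.tendsto_surface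
  have hη2 : MemLp η 2 := hηH1.1
  have hψ := hφH1.1
  have hDc : MemLp (fun x => fderiv ℝ η x c) 2 := by
    simp_rw [← inner_gradient_left]
    simp_rw [real_inner_comm c]
    exact ContinuousLinearMap.comp_memLp' (innerSL ℝ c) hgη
  have hDx : MemLp (fun x => fderiv ℝ η x x) 2 := by
    simp_rw [← inner_gradient_left]
    simp_rw [real_inner_comm]
    exact hxη
  have hcG : MemLp (fun x => ⟪c, Gx x⟫_ℝ) 2 :=
    ContinuousLinearMap.comp_memLp' (innerSL ℝ c) hGx
  have hηGy : MemLp (fun x => η x * Gy x) 2 :=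
    hGy.mul' (p := ⊤) (memLp_top_of_bound hηc.aestronglyMeasurable M (ae_of_all _ hM))
  have hS : MemLp (fun x => ⟪x, Gx x⟫_ℝ + η x * Gy x) 2 := hxG.add hηGy
  have hN : MemLp (fun x => η x - fderiv ℝ η x x) 2 := hη2.sub hDx
  have hkin : ∀ᵐ x, Gy x - fderiv ℝ η x (Gx x) = -fderiv ℝ η x c := by
    filter_upwards [hsol.kinematic] with x hx
    rw [hx, real_inner_comm, inner_gradient_left, map_sub]
    ring
  have hnorm : ∀ x, ∑ i, components b Gx Gy i x * ((frame b i).2 - fderiv ℝ η x (frame b i).1) =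
      Gy x - fderiv ℝ η x (Gx x) := fun x => sum_components_mul_normal b Gx Gy _ x
  have hcx : ∀ x, ∑ i, coord b i (x, η x) * ((frame b i).2 - fderiv ℝ η x (frame b i).1) =
      η x - fderiv ℝ η x x := fun x => sum_coord_mul_normal b _ (x, η x)
  have hcc : ∀ x, ∑ i, coord b i (c, (0 : ℝ)) * ((frame b i).2 - fderiv ℝ η x (frame b i).1) =
      -fderiv ℝ η x c := fun x => by
    rw [sum_coord_mul_normal b _ (c, (0 : ℝ))]
    simp
  have hcG' : ∀ x, ∑ i, coord b i (c, (0 : ℝ)) * components b Gx Gy i x = ⟪c, Gx x⟫_ℝ := fun x => by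
    rw [sum_coord_mul_components b Gx Gy (c, (0 : ℝ))]
    simp
  have hxG' : ∀ x, ∑ i, coord b i (x, η x) * components b Gx Gy i x =
      ⟪x, Gx x⟫_ℝ + η x * Gy x := fun x => sum_coord_mul_components b Gx Gy (x, η x) x
  -- the energy identity
  have hE := D.integral_energy hsol.tendsto_potential hψ (by
    simp_rw [hnorm]
    refine hDc.neg.ae_eq ?_
    filter_upwards [hkin] with x hx
    exact hx.symm)
  have hE' : ∫ p in subgraph η, ∑ i, fderiv ℝ φ p (frame b i) ^ 2 =
      ∫ x, φ (x, η x) * -fderiv ℝ η x c := by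
    rw [hE]
    refine integral_congr_ae ?_
    filter_upwards [hkin] with x hx
    simp only [hnorm, hx]
  -- the curl identity
  have iB : Integrable fun x => (⟪x, Gx x⟫_ℝ + η x * Gy x) * -fderiv ℝ η x c -
      ⟪c, Gx x⟫_ℝ * (η x - fderiv ℝ η x x) :=
    (hS.integrable_mul hDc.neg).sub (hcG.integrable_mul hN)
  have hC := D.integral_curl_of_integrable (sum_coord_smul_frame b)
    (fun i => coord b i (c, (0 : ℝ))) hψ (by simp_rw [hcc]; exact hDc.neg)
    (by simp_rw [hcx]; exact hN) (by simp_rw [hcc, hcx, hcG', hxG']; exact iB)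
  simp_rw [hcc, hcx, hcG', hxG'] at hC
  -- the Rellich identity
  have hRe : ∀ x, ∑ i, ((∑ j, coord b j (x, η x) * components b Gx Gy j x) *
      components b Gx Gy i x - 1 / 2 * ((∑ j, components b Gx Gy j x ^ 2) *
      coord b i (x, η x))) * ((frame b i).2 - fderiv ℝ η x (frame b i).1) =
      (⟪x, Gx x⟫_ℝ + η x * Gy x) * (Gy x - fderiv ℝ η x (Gx x)) -
        1 / 2 * (‖Gx x‖ ^ 2 + Gy x ^ 2) * (η x - fderiv ℝ η x x) := by
    intro x
    rw [← hnorm, ← hcx, ← hxG', ← sum_components_sq b, Finset.mul_sum, Finset.mul_sum,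
      ← Finset.sum_sub_distrib]
    exact Finset.sum_congr rfl fun i _ => by ring
  have iη : Integrable fun x => g * (η x * (η x - fderiv ℝ η x x)) :=
    (hη2.integrable_mul hN).const_mul g
  have hRa : ∀ᵐ x, ((⟪x, Gx x⟫_ℝ + η x * Gy x) * -fderiv ℝ η x c -
      ⟪c, Gx x⟫_ℝ * (η x - fderiv ℝ η x x)) + g * (η x * (η x - fderiv ℝ η x x)) =
      (⟪x, Gx x⟫_ℝ + η x * Gy x) * (Gy x - fderiv ℝ η x (Gx x)) -
        1 / 2 * (‖Gx x‖ ^ 2 + Gy x ^ 2) * (η x - fderiv ℝ η x x) := by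
    filter_upwards [hkin, hsol.bernoulli] with x h1 h2
    rw [h1]
    -- Bernoulli's law replaces `|G|²/2` by `c·G - gη`, multiplied by `X·N = η - x·∇η`.
    linear_combination (η x - fderiv ℝ η x x) * h2
  have hR := D.integral_rellich_of_integrable (sum_coord_smul_frame b) hX (by
    simp_rw [hRe]
    exact (iB.add iη).congr hRa)
  simp_rw [hRe] at hR
  rw [← integral_congr_ae hRa, integral_add iB iη, integral_const_mul] at hR
  -- the surface integral
  have hV : ∫ x, η x * (η x - fderiv ℝ η x x) =
      (1 + (Fintype.card ι : ℝ) / 2) * ∫ x, η x ^ 2 := by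
    have h1 := integral_mul_fderiv_self D.contDiff hη2 hDx
    rw [Module.finrank_eq_card_basis b.toBasis] at h1
    have h2 : ∀ x, η x * (η x - fderiv ℝ η x x) = η x ^ 2 - η x * fderiv ℝ η x x := fun x => by ring
    simp_rw [h2]
    have h3 : Integrable fun x => η x * fderiv ℝ η x x := hη2.integrable_mul hDx
    rw [integral_sub hη2.integrable_sq h3, h1]
    ring
  rw [Fintype.card_option] at hR hC
  push_cast at hR hC
  rw [hV] at hR
  rw [← hE'] at hC
  -- The common surface integral cancels. With `m = card ι`, the energy coefficients add up to `(2 -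
  -- (m + 1)) + 2m = m + 1`.
  linear_combination 2 * hR + 2 * hC

end SolitaryWave

end DeepWater

end

/-! ### Nonexistence from the sign of the virial identity -/

theorem mainTheorem2 (n : ℕ) (hn : 2 ≤ n) (g : ℝ) (hg : g ≤ 0)
    (c : DeepWater.Horiz n) (η : DeepWater.Horiz n → ℝ) (φ : DeepWater.Horiz n × ℝ → ℝ)
    (Gx : DeepWater.Horiz n → DeepWater.Horiz n) (Gy : DeepWater.Horiz n → ℝ)
    (hη : ContDiff ℝ 1 η)
    (hφ : ContDiffOn ℝ ∞ φ (DeepWater.fluidDomain η))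
    (hφc : ContinuousOn φ (closure (DeepWater.fluidDomain η)))
    (hsol : DeepWater.IsSolitaryWave g c η φ Gx Gy)
    (hηH1 : DeepWater.MemH1 η)
    (hxη : MemLp (fun x : DeepWater.Horiz n => ⟪x, gradient η x⟫_ℝ) 2 volume)
    (hφx : MemLp (DeepWater.gradX φ) 2 (volume.restrict (DeepWater.fluidDomain η)))
    (hφy : MemLp (DeepWater.derivY φ) 2 (volume.restrict (DeepWater.fluidDomain η)))
    (hXφ : MemLp (fun p : DeepWater.Horiz n × ℝ =>
        ⟪p.1, DeepWater.gradX φ p⟫_ℝ + p.2 * DeepWater.derivY φ p) 2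
      (volume.restrict (DeepWater.fluidDomain η)))
    (hφH1 : DeepWater.MemH1 (fun x => φ (x, η x)))
    (hxG : MemLp (fun x : DeepWater.Horiz n => ⟪x, Gx x⟫_ℝ) 2 volume) :
    (∀ p ∈ closure (DeepWater.fluidDomain η), φ p = 0) ∧
      (g ≠ 0 ∨ c ≠ 0 → ∀ x, η x = 0) := by
  let b := stdOrthonormalBasis ℝ (DeepWater.Horiz n)
  have D := hsol.harmonicBelow hη hφ hφc hφx hφy b
  have hO : IsOpen (DeepWater.subgraph η) := D.isOpen
  have hda : ∀ p ∈ DeepWater.subgraph η, DifferentiableAt ℝ φ p := fun p hp =>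
    (D.contDiffOn.contDiffAt (hO.mem_nhds hp)).differentiableAt (by simp)
  have hX : MemLp (fun p => ∑ i, DeepWater.coord b i p * fderiv ℝ φ p (DeepWater.frame b i)) 2
      (volume.restrict (DeepWater.subgraph η)) := by
    refine hXφ.ae_eq ?_
    filter_upwards [ae_restrict_mem hO.measurableSet] with p hp
    rw [DeepWater.HarmonicBelow.sum_coord_mul_apply (DeepWater.sum_coord_smul_frame b),
      DeepWater.gradX, DeepWater.derivY, real_inner_comm, DeepWater.inner_gradient_left,
      DeepWater.fderiv_slice_fst (hda p hp), DeepWater.deriv_slice_snd (hda p hp),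
      ← smul_eq_mul, ← map_smul, ← map_add]
    simp
  have hvir := hsol.virial D hηH1 hxη hX hφH1 hxG
  set I := ∫ p in DeepWater.subgraph η, ∑ i, fderiv ℝ φ p (DeepWater.frame b i) ^ 2 with hI
  set J := ∫ x, η x ^ 2 with hJ
  have hI0 : 0 ≤ I := integral_nonneg fun p => Finset.sum_nonneg fun i _ => sq_nonneg _
  have hJ0 : 0 ≤ J := integral_nonneg fun x => sq_nonneg _
  have hgJ : g * J ≤ 0 := mul_nonpos_of_nonpos_of_nonneg hg hJ0
  set m : ℝ := (Fintype.card (Fin (Module.finrank ℝ (DeepWater.Horiz n))) : ℝ) with hm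
  have hm0 : 0 ≤ m := Nat.cast_nonneg _
  have h1 : 0 ≤ (m + 1) * I := by positivity
  have h2 : (m + 2) * (g * J) ≤ 0 := mul_nonpos_of_nonneg_of_nonpos (by positivity) hgJ
  have hIz : I = 0 := by
    have : (m + 1) * I = 0 := le_antisymm (hvir.le.trans h2) h1
    exact (mul_eq_zero.1 this).resolve_left (by positivity)
  have hgJz : g * J = 0 := by
    have : (m + 2) * (g * J) = 0 := by rw [← hvir, hIz, mul_zero]
    exact (mul_eq_zero.1 this).resolve_left (by positivity)
  -- Only the vertical component, index `none`, is needed; its continuity upgrades almost everywhere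
  -- to everywhere on the open domain.
  have hvert : ∀ p ∈ DeepWater.subgraph η, fderiv ℝ φ p (0, 1) = 0 := by
    have hae := (integral_eq_zero_iff_of_nonneg
      (fun p => Finset.sum_nonneg fun i _ => sq_nonneg _)
      (integrable_finsetSum _ fun i _ => (D.memLp i).integrable_sq)).1 hIz
    have hae' : (fun p => fderiv ℝ φ p (0, 1)) =ᵐ[volume.restrict (DeepWater.subgraph η)]
        fun _ => 0 := by
      filter_upwards [hae] with p hp
      have := (Finset.sum_eq_zero_iff_of_nonneg fun i _ => sq_nonneg _).1 hp none
        (Finset.mem_univ _)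
      exact pow_eq_zero_iff two_ne_zero |>.1 this
    exact Measure.eqOn_open_of_ae_eq hae' hO (D.contDiffOn_deriv none).continuousOn
      continuousOn_const
  have hφz := DeepWater.eq_zero_of_fderiv_vertical_eq_zero hη.continuous
    (D.contDiffOn.differentiableOn (by simp)) hφc hsol.tendsto_potential hvert
  refine ⟨hφz, ?_⟩
  by_cases hg0 : g = 0
  · intro h
    have hc : c ≠ 0 := h.resolve_left (not_not.2 hg0)
    -- Since `φ = 0` in the domain, the approximating gradients vanish at every depth, so their
    -- limit vanishes almost everywhere; this is the case of an empty exceptional set.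
    have hGz : ∀ i, ∀ᵐ x, DeepWater.components b Gx Gy i x = 0 := by
      intro i
      have hone : DeepWater.TendstoLocLp 2 (fun _ _ => (1 : ℝ)) (fun _ : DeepWater.Horiz n => 1) :=
        DeepWater.TendstoLocLp.of_continuous 2 continuous_const
      have hT := DeepWater.TendstoLocLp.mul (p := 2) (q := 2) (r := 1) one_le_two le_rfl
        (D.boundary i) hone
      have := hT.ae_eq_zero_of_forall_notMem (S := ∅) MeasurableSet.empty (by
        intro s hs x _
        have hmem : (x, η x - s) ∈ DeepWater.subgraph η := by
          simpa [DeepWater.subgraph] using hs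
        have hz : φ =ᶠ[𝓝 (x, η x - s)] fun _ => 0 := by
          filter_upwards [hO.mem_nhds hmem] with q hq
          exact hφz q (subset_closure hq)
        rw [hz.fderiv_eq]
        simp)
      filter_upwards [this] with x hx
      simpa using hx
    -- With zero boundary gradient the kinematic condition reads `0 = -c·∇η`.
    have hcη : (fun x => fderiv ℝ η x c) =ᵐ[volume] fun _ => 0 := by
      filter_upwards [ae_all_iff.2 hGz, hsol.kinematic] with x hx hk
      have hy : Gy x = 0 := hx none
      have hxx : Gx x = 0 := by
        rw [← b.sum_repr' (Gx x)]
        refine Finset.sum_eq_zero fun i _ => ?_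
        have : ⟪b i, Gx x⟫_ℝ = 0 := hx (some i)
        rw [this, zero_smul]
      rw [hy, hxx, real_inner_comm, DeepWater.inner_gradient_left, zero_sub, map_neg] at hk
      linarith
    have hcont : Continuous fun x => fderiv ℝ η x c :=
      (hη.continuous_fderiv one_ne_zero).clm_apply continuous_const
    have hcη' := (hcont.ae_eq_iff_eq volume continuous_const).1 hcη
    exact DeepWater.eq_zero_of_fderiv_apply_eq_zero (hη.differentiable one_ne_zero)
      hsol.tendsto_surface hc fun x => congrFun hcη' x
  · intro _
    have hJz : J = 0 := (mul_eq_zero.1 hgJz).resolve_left hg0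
    have hae := (integral_eq_zero_iff_of_nonneg (fun x => sq_nonneg (η x))
      hηH1.1.integrable_sq).1 hJz
    have hae' : η =ᵐ[volume] fun _ => 0 := by
      filter_upwards [hae] with x hx
      exact pow_eq_zero_iff two_ne_zero |>.1 hx
    have := (hη.continuous.ae_eq_iff_eq volume continuous_const).1 hae'
    exact fun x => congrFun this x
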